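/- For integers $n,m\ge 0$ and $p\in[0,1]$ let each vertex $v\in V=\{1,\dots,n\}$ choose a random set $S_v$ of labels from $\mathcal M=\{1,\dots,m\}$, each vertex choosing each label with probability $p$, independently over all vertex–label pairs. Let $G_{n,m,p}$ be the graph on $V$ in which distinct vertices $u,v$ are adjacent if and only if $S_u\cap S_v\neq\emptyset$, let $B_{n,m,p}$ be the bipartite graph on $V\cup\mathcal M$ with edges $\{(v,i): i\in S_v\}$, and let $L_i=\{v: i\in S_v\}$; the family $\{L_i\}_{i\in\mathcal M}$ is the label representation. A bipartite vertex–label graph $B$ on $V\cup\mathcal M$ gives rise to a graph $G$ on $V$ if distinct vertices $u,v$ are adjacent in $G$ exactly when they have a common neighbour in $\mathcal M$ in $B$. Fix $\alpha$ with $0<\alpha<1$, let $m=m(n)$ be $n^\alpha$ rounded to an integer (that is, $|m(n)-n^\alpha|<1$ for every $n$), and let $p=p(n)\in[0,1]$ satisfy $p=\Omega\bigl(1/\sqrt{nm}\bigr)$ and $mp^2=O(1)$ as $n\to\infty$. Then, with probability tending to $1$ as $n\to\infty$, both of the following hold. (i) $B_{n,m,p}$ is uniquely determined by $G_{n,m,p}$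 up to permutations of the labels: every bipartite vertex–label graph on $V\cup\mathcal M$ (with the same $n$ and $m$) that gives rise to $G_{n,m,p}$ is obtained from $B_{n,m,p}$ by a permutation of $\mathcal M$ that leaves every vertex of $V$ fixed. Equivalently, the label representation $\{L_i\}$ is determined by $G_{n,m,p}$ up to permutations of the labels. (ii) Label reconstruction by maximum likelihood is solvable: among the bipartite vertex–label graphs that give rise to $G_{n,m,p}$, considered up to permutations of the labels, there is one, $B^*$, such that $\Pr(B^*\mid G_{n,m,p})>\Pr(B\mid G_{n,m,p})$ for every other one $B$. Here $\Pr(B\mid G)$ is the conditional probability, given that the random graph equals $G$, that the associated bipartite graph equals $B$ up to a permutation of the labels. -/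

import Mathlib

open MeasureTheory ProbabilityTheory Filter Asymptotics

namespace RandomIntersection

/-- The set `L_i` of vertices that have chosen label `i`, where `S v` is the set of labels chosen
by the vertex `v`. The family `i ↦ L_i` is the label representation. -/
def labelSet {V M : Type*} (S : V → Set M) (i : M) : Set V := {v | i ∈ S v}

/-- The intersection graph of the label choices `S`: distinct vertices are adjacent iff they have
a label in common. -/
def intersectionGraph {V M : Type*} (S : V → Set M) : SimpleGraph V where
  Adj u v := u ≠ v ∧ (S u ∩ S v).Nonempty
  symm := ⟨fun u v h => ⟨h.1.symm, by rw [Set.inter_comm]; exact h.2⟩⟩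
  loopless := ⟨fun _ h => h.1 rfl⟩

/-- The bipartite vertex–label graph associated to the label choices `S`: its vertex set is
`V ∪ M` and its edges are the pairs `(v, i)` with `i ∈ S v`. -/
def bipartiteGraph {V M : Type*} (S : V → Set M) : SimpleGraph (V ⊕ M) where
  Adj
    | .inl v, .inr i => i ∈ S v
    | .inr i, .inl v => i ∈ S v
    | _, _ => False
  symm := ⟨by rintro (u | i) (v | j) h <;> exact h⟩
  loopless := ⟨by rintro (u | i) h <;> exact h⟩

/-- Two vertex–label graphs agree up to a permutation of the labels (the vertices stay fixed). -/
def EqUpToLabels {V M : Type*} (B B' : SimpleGraph (V ⊕ M)) : Prop :=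
  ∃ σ : Equiv.Perm M, B' = B.map (Equiv.sumCongr (Equiv.refl V) σ).toEmbedding

/-- Agreement of the vertex–label graphs up to a permutation of the labels is the same as
agreement of the label representations up to a permutation of the labels. -/
theorem eqUpToLabels_bipartiteGraph_iff {V M : Type*} (S T : V → Set M) :
    EqUpToLabels (bipartiteGraph S) (bipartiteGraph T) ↔
      ∃ σ : Equiv.Perm M, ∀ i, labelSet T (σ i) = labelSet S i := by
  constructor
  · rintro ⟨σ, h⟩
    refine ⟨σ, fun i => Set.ext fun v => ?_⟩
    have h2 : (bipartiteGraph T).Adj (.inl v) (.inr (σ i)) ↔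
        (bipartiteGraph S).Adj (.inl v) (.inr i) := by
      rw [h]
      exact SimpleGraph.map_adj_apply (f := (Equiv.sumCongr (Equiv.refl V) σ).toEmbedding)
        (a := .inl v) (b := .inr i)
    exact h2
  · rintro ⟨σ, h⟩
    have key : ∀ v i, σ i ∈ T v ↔ i ∈ S v := fun v i => Set.ext_iff.1 (h i) v
    refine ⟨σ, ?_⟩
    ext a b
    obtain ⟨a, rfl⟩ := (Equiv.sumCongr (Equiv.refl V) σ).surjective a
    obtain ⟨b, rfl⟩ := (Equiv.sumCongr (Equiv.refl V) σ).surjective b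
    refine Iff.trans ?_ (SimpleGraph.map_adj_apply
      (f := (Equiv.sumCongr (Equiv.refl V) σ).toEmbedding) (a := a) (b := b)).symm
    rcases a with u | i <;> rcases b with v | j
    · exact Iff.rfl
    · exact key u j
    · exact key v i
    · exact Iff.rfl

/-- The law of the label choices in the random intersection graphs model with vertices `Fin n`,
labels `Fin m` and selection probability `p`: the sets `S v` are independent over `v`, and `S v`
contains each label independently with probability `p`. -/
noncomputable def labelLaw (n m : ℕ) (p : unitInterval) : Measure (Fin n → Set (Fin m)) :=
  Measure.pi fun _ => setBernoulli Set.univ p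

/-- The conditional probability `Pr(B | G)`, where `B` is the vertex–label graph of the label
choices `S`, considered up to permutations of the labels, and `G` is the observed graph. -/
noncomputable def posterior (n m : ℕ) (p : unitInterval) (G : SimpleGraph (Fin n))
    (S : Fin n → Set (Fin m)) : ENNReal :=
  (labelLaw n m p)[{T | EqUpToLabels (bipartiteGraph S) (bipartiteGraph T)} |
    {T | intersectionGraph T = G}]

/-- Label reconstruction from `G` is solvable by maximum likelihood: among the vertex–label graphs
that give rise to `G`, considered up to permutations of the labels, there is one whose conditional
probability given `G` strictly exceeds that of each of the others. -/
def MaximumLikelihoodSolvable (n m : ℕ) (p : unitInterval) (G : SimpleGraph (Fin n)) : Prop :=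
  ∃ S : Fin n → Set (Fin m), intersectionGraph S = G ∧
    ∀ T : Fin n → Set (Fin m), intersectionGraph T = G →
      ¬ EqUpToLabels (bipartiteGraph S) (bipartiteGraph T) →
        posterior n m p G T < posterior n m p G S

end RandomIntersection

/-! A graph with the same intersection graph arises from `m` sets `members T j`, which are cliques
and together cover every edge. The proof shows that, for pseudorandom label choices `S`, the only
such cover by `m` cliques is the family of the `L_i` themselves.

Call an ordered pair of distinct vertices private to `i` if `i` is its only common label, and give
each such pair the weight `1 / #(privatePairs S i)`. The total weight is `m`. The crux is that a
clique weighs at most 1, with equality only for a full `L_i`. Since `m` cliques cover total weight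
`m`, each weighs exactly 1, so each is some `L_i`; every label occurs because its private pairs must
be covered (`Typical.eqUpToLabels`).

A clique inside some `L_i` sees only private pairs of `i`, so its bound is immediate
(`Typical.cliqueWeight_of_subset`). For any other clique (`Typical.cliqueWeight_lt_one`), small size
already bounds the weight. A large one lies almost entirely in a single `L_i`
(`Typical.exists_card_sdiff_members_le`): two disjoint `d`-sets are never completely joined through
labels outside `sharedLabels`, so the few labels shared within a sample of `d` vertices cover nearly
all of the clique. A vertex of the clique outside `L_i` then costs a constant fraction of the
private pairs of `i`, while all other labels contribute only `O(1/d)`.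

The pseudorandomness `Typical` follows from exponential moments and union bounds
(`prob_not_typical_le`). As `mp² = O(1)`, a vertex has at most `κ = O(√m)` labels with `pκ = O(1)`,
so a fresh vertex misses all of them with probability at least a constant `θ > 0`. The lower bound
on `p` makes `np` a power of `n`, and `d` is a much smaller power that still dominates `log n`. Once
the representation is unique, maximum likelihood has no competitor. -/

namespace RandomIntersection

open scoped Classical Finset

/-! ### Conditioning and exponential tail bounds for product measures -/

section ProductMeasure

variable {ι X : Type*} [Fintype ι] [Finite X] [MeasurableSpace X] [DiscreteMeasurableSpace X]

/-- Resampling the coordinates in `A` independently of the others preserves a product measure. -/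
theorem measurePreserving_piecewise (ν : ι → Measure X) [∀ i, IsProbabilityMeasure (ν i)]
    (A : Finset ι) :
    MeasurePreserving (fun z : (ι → X) × (ι → X) => A.piecewise z.1 z.2)
      ((Measure.pi ν).prod (Measure.pi ν)) (Measure.pi ν) := by
  refine ⟨.of_discrete, (Measure.pi_eq fun s hs => ?_).symm⟩
  rw [Measure.map_apply .of_discrete (.of_discrete)]
  have h : (fun z : (ι → X) × (ι → X) => A.piecewise z.1 z.2) ⁻¹' Set.univ.pi s =
      (Set.univ.pi fun i => if i ∈ A then s i else Set.univ) ×ˢ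
        (Set.univ.pi fun i => if i ∈ A then Set.univ else s i) := by
    ext ⟨σ, τ⟩
    simp only [Set.mem_preimage, Set.mem_pi, Set.mem_univ, true_implies, Set.mem_prod]
    rw [← forall_and]
    refine forall_congr' fun i => ?_
    by_cases hi : i ∈ A <;> simp [Finset.piecewise, hi]
  rw [h, Measure.prod_prod, Measure.pi_pi, Measure.pi_pi, ← Finset.prod_mul_distrib]
  refine Finset.prod_congr rfl fun i _ => ?_
  by_cases hi : i ∈ A <;> simp [hi]

/-- To bound the probability of an event it suffices to bound its conditional probability given
any values of the coordinates in `A`. -/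
theorem pi_real_le_of_forall_piecewise (ν : ι → Measure X) [∀ i, IsProbabilityMeasure (ν i)]
    (A : Finset ι) (E : Set (ι → X)) (c : ℝ)
    (h : ∀ σ, (Measure.pi ν).real {S | A.piecewise σ S ∈ E} ≤ c) : (Measure.pi ν).real E ≤ c := by
  have h1 := (measurePreserving_piecewise ν A).measureReal_preimage
    (s := E) (MeasurableSet.of_discrete.nullMeasurableSet)
  rw [← h1, ← integral_indicator_one .of_discrete, integral_prod _ Integrable.of_finite]
  calc _ ≤ ∫ _ : ι → X, c ∂(Measure.pi ν) := by
        refine integral_mono Integrable.of_finite Integrable.of_finite fun σ => ?_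
        have := h σ
        rw [← integral_indicator_one .of_discrete] at this
        exact this
    _ = c := by simp

/-- The exponential of the count is a product of functions of single coordinates, so independence
factors its integral. Both tail bounds below come from this formula. -/
theorem integral_exp_card_filter (ν : ι → Measure X) [∀ i, IsProbabilityMeasure (ν i)]
    (B : Finset ι) (U : ι → Set X) (s : ℝ) :
    ∫ S, Real.exp (s * #{v ∈ B | S v ∈ U v}) ∂(Measure.pi ν) =
      ∏ v ∈ B, (1 + (Real.exp s - 1) * (ν v).real (U v)) := by
  have h1 : ∀ S : ι → X, Real.exp (s * #{v ∈ B | S v ∈ U v}) =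
      ∏ v, (1 + (if v ∈ B then (Real.exp s - 1) else 0) * (U v).indicator 1 (S v)) := by
    intro S
    rw [Finset.card_filter]
    push_cast
    rw [Finset.mul_sum, Real.exp_sum, ← Finset.prod_subset (Finset.subset_univ B)]
    · refine Finset.prod_congr rfl fun v hv => ?_
      by_cases h : S v ∈ U v <;> simp [h, hv]
    · intro v _ hv
      simp [hv]
  simp_rw [h1]
  rw [integral_fintype_prod_eq_prod
    (f := fun v x => 1 + (if v ∈ B then (Real.exp s - 1) else 0) * (U v).indicator 1 x)]
  rw [← Finset.prod_subset (Finset.subset_univ B)]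
  · refine Finset.prod_congr rfl fun v hv => ?_
    rw [integral_add Integrable.of_finite Integrable.of_finite, integral_const_mul,
      integral_indicator_one .of_discrete]
    simp [hv]
  · intro v _ hv
    simp [hv]

theorem integral_markov {Ω : Type*} [Finite Ω] [MeasurableSpace Ω] [DiscreteMeasurableSpace Ω]
    (μ : Measure Ω) [IsFiniteMeasure μ] (E : Set Ω) (f : Ω → ℝ) (hf : ∀ ω, 0 ≤ f ω)
    (h : ∀ ω ∈ E, 1 ≤ f ω) : μ.real E ≤ ∫ ω, f ω ∂μ := by
  rw [← integral_indicator_one .of_discrete]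
  refine integral_mono Integrable.of_finite Integrable.of_finite fun ω => ?_
  by_cases hω : ω ∈ E
  · simpa [hω] using h ω hω
  · simpa [hω] using hf ω

/-- Upper tail bound for the number of independent events that occur. -/
theorem pi_real_le_card_le_exp (ν : ι → Measure X) [∀ i, IsProbabilityMeasure (ν i)]
    (B : Finset ι) (U : ι → Set X) (q t : ℝ) (hU : ∀ v ∈ B, (ν v).real (U v) ≤ q) :
    (Measure.pi ν).real {S | t ≤ #{v ∈ B | S v ∈ U v}} ≤ Real.exp (2 * q * #B - t) := by
  -- Markov's inequality with exponent `s = 1`; the factor 2 in the bound comes from `e - 1 < 2`.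
  calc _ ≤ ∫ S, Real.exp (1 * #{v ∈ B | S v ∈ U v}) * Real.exp (-t) ∂(Measure.pi ν) := by
        refine integral_markov _ _ _ (fun _ => by positivity) fun S hS => ?_
        rw [← Real.exp_add, Real.one_le_exp_iff]
        have : t ≤ #{v ∈ B | S v ∈ U v} := hS
        linarith
    _ = (∏ v ∈ B, (1 + (Real.exp 1 - 1) * (ν v).real (U v))) * Real.exp (-t) := by
        rw [integral_mul_const, integral_exp_card_filter]
    _ ≤ (∏ v ∈ B, Real.exp (2 * q)) * Real.exp (-t) := by
        refine mul_le_mul_of_nonneg_right (Finset.prod_le_prod (fun v hv => ?_) fun v hv => ?_)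
          (Real.exp_pos _).le
        · have : 0 ≤ (ν v).real (U v) := measureReal_nonneg
          have := Real.add_one_le_exp (1 : ℝ)
          exact add_nonneg zero_le_one (mul_nonneg (by linarith) ‹_›)
        · have h0 : 0 ≤ (ν v).real (U v) := measureReal_nonneg
          have := Real.exp_one_lt_d9
          have h2 := Real.add_one_le_exp (2 * q)
          have := hU v hv
          nlinarith
    _ = _ := by
        rw [Finset.prod_const, ← Real.exp_nat_mul, ← Real.exp_add]
        congr 1
        ring

/-- Lower tail bound for the number of independent events that occur. -/
theorem pi_real_card_le_le_exp (ν : ι → Measure X) [∀ i, IsProbabilityMeasure (ν i)]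
    (B : Finset ι) (U : ι → Set X) (q t : ℝ) (hU : ∀ v ∈ B, q ≤ (ν v).real (U v)) :
    (Measure.pi ν).real {S | #{v ∈ B | S v ∈ U v} ≤ t} ≤ Real.exp (t - q * #B / 2) := by
  have he : Real.exp (-1) ≤ 1 / 2 := by
    rw [Real.exp_neg, inv_eq_one_div]
    have := Real.add_one_le_exp (1 : ℝ)
    gcongr
    linarith
  -- Now `s = -1`, and `1 - e⁻¹ ≥ 1/2` gives the denominator 2.
  calc _ ≤ ∫ S, Real.exp (-1 * #{v ∈ B | S v ∈ U v}) * Real.exp t ∂(Measure.pi ν) := by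
        refine integral_markov _ _ _ (fun _ => by positivity) fun S hS => ?_
        rw [← Real.exp_add, Real.one_le_exp_iff]
        have : #{v ∈ B | S v ∈ U v} ≤ t := hS
        linarith
    _ = (∏ v ∈ B, (1 + (Real.exp (-1) - 1) * (ν v).real (U v))) * Real.exp t := by
        rw [integral_mul_const, integral_exp_card_filter]
    _ ≤ (∏ v ∈ B, Real.exp (-(q / 2))) * Real.exp t := by
        refine mul_le_mul_of_nonneg_right (Finset.prod_le_prod (fun v hv => ?_) fun v hv => ?_)
          (Real.exp_pos _).le
        · have : (ν v).real (U v) ≤ 1 := measureReal_le_one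
          have h0 : 0 ≤ (ν v).real (U v) := measureReal_nonneg
          have := Real.exp_pos (-1)
          nlinarith
        · have h0 : 0 ≤ (ν v).real (U v) := measureReal_nonneg
          have h2 := Real.add_one_le_exp (-(q / 2))
          have := hU v hv
          nlinarith
    _ = _ := by
        rw [Finset.prod_const, ← Real.exp_nat_mul, ← Real.exp_add]
        congr 1
        ring

end ProductMeasure

theorem pi_real_forall_mem_le_pow {ι X : Type*} [Fintype ι] [MeasurableSpace X]
    (ν : ι → Measure X) [∀ i, IsProbabilityMeasure (ν i)]
    (B : Finset ι) (U : ι → Set X) (q : ℝ) (hU : ∀ v ∈ B, (ν v).real (U v) ≤ q) :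
    (Measure.pi ν).real {S | ∀ v ∈ B, S v ∈ U v} ≤ q ^ #B := by
  have h : {S : ι → X | ∀ v ∈ B, S v ∈ U v} =
      Set.univ.pi fun v => if v ∈ B then U v else Set.univ := by
    ext S
    simp only [Set.mem_ofPred_eq, Set.mem_pi, Set.mem_univ, true_implies]
    refine forall_congr' fun v => ?_
    by_cases hv : v ∈ B <;> simp [hv]
  rw [h, measureReal_def, Measure.pi_pi, ENNReal.toReal_prod,
    ← Finset.prod_subset (Finset.subset_univ B)]
  · rw [← Finset.prod_const]
    refine Finset.prod_le_prod (fun _ _ => ENNReal.toReal_nonneg) fun v hv => ?_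
    rw [if_pos hv]
    exact hU v hv
  · intro v _ hv
    simp [hv]

/-! ### Random subsets of the labels -/

section Bernoulli

variable {M : Type*} [Fintype M] (p : unitInterval)

open unitInterval in
/-- The law of the truth value of an event of probability `p`. -/
noncomputable def propLaw : Measure Prop :=
  toNNReal p • Measure.dirac True + toNNReal (σ p) • Measure.dirac False

instance : IsProbabilityMeasure (propLaw p) := by
  unfold propLaw; infer_instance

theorem propLaw_real_true : (propLaw p).real {x | x} = p := by
  simp [propLaw, measureReal_def]

theorem setBernoulli_univ_eq_map :
    setBernoulli (Set.univ : Set M) p =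
      (Measure.pi fun _ : M => propLaw p).map fun x => {i | x i} := by
  rw [setBernoulli_eq_map, ← Measure.infinitePi_eq_pi]
  simp [propLaw]

theorem setBernoulli_univ_real_apply (E : Set (Set M)) :
    (setBernoulli (Set.univ : Set M) p).real E =
      (Measure.pi fun _ : M => propLaw p).real {x | {i | x i} ∈ E} := by
  rw [setBernoulli_univ_eq_map, map_measureReal_apply .of_discrete .of_discrete]
  rfl

theorem setBernoulli_univ_real_le_card_inter (X : Finset M) (t : ℝ) :
    (setBernoulli (Set.univ : Set M) p).real {s | t ≤ #{i ∈ X | i ∈ s}} ≤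
      Real.exp (2 * p * #X - t) := by
  rw [setBernoulli_univ_real_apply]
  refine le_trans (le_of_eq ?_)
    (pi_real_le_card_le_exp _ X (fun _ => {x | x}) p t fun _ _ => (propLaw_real_true p).le)
  rfl

theorem integral_prod_mem_setBernoulli (f : M → Prop → ℝ) :
    ∫ s, ∏ i, f i (i ∈ s) ∂(setBernoulli (Set.univ : Set M) p) =
      ∏ i, (p * f i True + (1 - p) * f i False) := by
  rw [setBernoulli_univ_eq_map, integral_map (Measurable.of_discrete.aemeasurable)
    (StronglyMeasurable.of_discrete.aestronglyMeasurable)]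
  simp only [Set.mem_ofPred_eq]
  rw [integral_fintype_prod_eq_prod]
  refine Finset.prod_congr rfl fun i _ => ?_
  rw [propLaw, integral_add_measure Integrable.of_finite Integrable.of_finite,
    integral_smul_nnreal_measure, integral_smul_nnreal_measure, integral_dirac, integral_dirac]
  simp [NNReal.smul_def]

theorem setBernoulli_univ_real_subset_disjoint (X Y : Finset M) (h : Disjoint X Y) :
    (setBernoulli (Set.univ : Set M) p).real {s | (∀ i ∈ X, i ∈ s) ∧ ∀ i ∈ Y, i ∉ s} =
      (p : ℝ) ^ #X * (1 - p) ^ #Y := by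
  rw [← integral_indicator_one .of_discrete]
  let f : M → Prop → ℝ := fun i x => if i ∈ X then (if x then 1 else 0) else
    if i ∈ Y then (if x then 0 else 1) else 1
  have h1 : ∀ s : Set M, Set.indicator {s | (∀ i ∈ X, i ∈ s) ∧ ∀ i ∈ Y, i ∉ s} (1 : Set M → ℝ) s =
      ∏ i, f i (i ∈ s) := by
    intro s
    by_cases hs : (∀ i ∈ X, i ∈ s) ∧ ∀ i ∈ Y, i ∉ s
    · rw [Set.indicator_of_mem (by exact hs), Finset.prod_eq_one]
      · rfl
      · intro i _
        by_cases hX : i ∈ X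
        · simp [f, hX, hs.1 i hX]
        · by_cases hY : i ∈ Y
          · simp [f, hX, hY, hs.2 i hY]
          · simp [f, hX, hY]
    · rw [Set.indicator_of_notMem (by exact hs), eq_comm, Finset.prod_eq_zero_iff]
      rw [not_and_or] at hs
      push Not at hs
      obtain ⟨i, hi, hs⟩ | ⟨i, hi, hs⟩ := hs
      · exact ⟨i, Finset.mem_univ _, by simp [f, hi, hs]⟩
      · have hX : i ∉ X := fun hX => Finset.disjoint_left.1 h hX hi
        exact ⟨i, Finset.mem_univ _, by simp [f, hX, hi, hs]⟩
  simp_rw [h1]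
  rw [integral_prod_mem_setBernoulli]
  have h2 : ∀ i, p * f i True + (1 - p) * f i False =
      (if i ∈ X then (p : ℝ) else 1) * (if i ∈ Y then 1 - (p : ℝ) else 1) := by
    intro i
    by_cases hX : i ∈ X
    · have hY : i ∉ Y := fun hY => Finset.disjoint_left.1 h hX hY
      simp [f, hX, hY]
    · by_cases hY : i ∈ Y <;> simp [f, hX, hY]
  rw [Finset.prod_congr rfl fun i _ => h2 i, Finset.prod_mul_distrib, Finset.prod_ite_mem,
    Finset.prod_ite_mem]
  simp

/-- The events of meeting pairwise disjoint sets of labels are independent. -/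
theorem setBernoulli_univ_real_forall_meets {κ : Type*} (A : Finset κ) (X : κ → Finset M)
    (h : (A : Set κ).PairwiseDisjoint X) :
    (setBernoulli (Set.univ : Set M) p).real {s | ∀ a ∈ A, ∃ i ∈ X a, i ∈ s} =
      ∏ a ∈ A, (1 - (1 - (p : ℝ)) ^ #(X a)) := by
  rw [← integral_indicator_one .of_discrete]
  have h1 : ∀ s : Set M, Set.indicator {s | ∀ a ∈ A, ∃ i ∈ X a, i ∈ s} (1 : Set M → ℝ) s =
      ∑ t ∈ A.powerset, (-1) ^ #t *
        Set.indicator {s | (∀ i ∈ (∅ : Finset M), i ∈ s) ∧ ∀ i ∈ t.biUnion X, i ∉ s}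
          (1 : Set M → ℝ) s := by
    intro s
    have h2 : Set.indicator {s | ∀ a ∈ A, ∃ i ∈ X a, i ∈ s} (1 : Set M → ℝ) s =
        ∏ a ∈ A, (1 - if ∀ i ∈ X a, i ∉ s then (1 : ℝ) else 0) := by
      by_cases hs : ∀ a ∈ A, ∃ i ∈ X a, i ∈ s
      · rw [Set.indicator_of_mem (by exact hs), Finset.prod_eq_one]
        · rfl
        · intro a ha
          rw [if_neg, sub_zero]
          push Not
          exact hs a ha
      · rw [Set.indicator_of_notMem (by exact hs), eq_comm, Finset.prod_eq_zero_iff]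
        push Not at hs
        obtain ⟨a, ha, hs⟩ := hs
        exact ⟨a, ha, by rw [if_pos hs, sub_self]⟩
    -- Inclusion–exclusion over the sets `X a` that are missed; disjointness later turns the size of
    -- their union into a sum, so that the expansion folds back into a product.
    rw [h2, Finset.prod_sub]
    refine Finset.sum_congr rfl fun t _ => ?_
    rw [Finset.prod_const_one, mul_one]
    congr 1
    by_cases ht : ∀ a ∈ t, ∀ i ∈ X a, i ∉ s
    · rw [Set.indicator_of_mem, Finset.prod_eq_one]
      · rfl
      · intro a ha
        rw [if_pos (ht a ha)]
      · refine ⟨by simp, fun i hi => ?_⟩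
        obtain ⟨a, ha, hi⟩ := Finset.mem_biUnion.1 hi
        exact ht a ha i hi
    · rw [Set.indicator_of_notMem, Finset.prod_eq_zero_iff]
      · push Not at ht
        obtain ⟨a, ha, i, hi, his⟩ := ht
        refine ⟨a, ha, if_neg ?_⟩
        push Not
        exact ⟨i, hi, his⟩
      · rintro ⟨-, h4⟩
        exact ht fun a ha i hi => h4 i (Finset.mem_biUnion.2 ⟨a, ha, hi⟩)
  simp_rw [h1]
  rw [integral_finsetSum _ fun _ _ => Integrable.of_finite, Finset.prod_sub]
  refine Finset.sum_congr rfl fun t ht => ?_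
  rw [integral_const_mul, integral_indicator_one .of_discrete,
    setBernoulli_univ_real_subset_disjoint p _ _ (Finset.disjoint_empty_left _),
    Finset.card_biUnion, Finset.prod_pow_eq_pow_sum]
  · simp
  · exact fun a ha b hb hab => h (Finset.mem_powerset.1 ht ha) (Finset.mem_powerset.1 ht hb) hab

end Bernoulli

/-! ### Structure of large cliques for typical label choices -/

section Typical

variable {V M : Type*} [Fintype V] [Fintype M] {S T : V → Set M} {N ρ : ℝ} {d : ℕ}

/-- The set of vertices that have chosen the label `i`, as a finset. -/
noncomputable def members (S : V → Set M) (i : M) : Finset V := {v | i ∈ S v}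

/-- The vertices other than `w` that have label `i` and share no other label with `w`. -/
noncomputable def privateNeighbors (S : V → Set M) (w : V) (i : M) : Finset V :=
  {x | x ≠ w ∧ i ∈ S x ∧ ∀ j ∈ S x, j ∈ S w → j = i}

/-- The labels that occur at two or more vertices of `A`. -/
noncomputable def sharedLabels (S : V → Set M) (A : Finset V) : Finset M :=
  {i | ∃ a ∈ A, ∃ b ∈ A, a ≠ b ∧ i ∈ S a ∧ i ∈ S b}

/-- The ordered pairs of distinct vertices whose only common label is `i`. -/
noncomputable def privatePairs (S : V → Set M) (i : M) : Finset (V × V) :=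
  {e | i ∈ S e.1 ∧ e.2 ∈ privateNeighbors S e.1 i}

/-- The finset `Q` is a clique of the intersection graph. -/
def IsLabelClique (S : V → Set M) (Q : Finset V) : Prop :=
  ∀ u ∈ Q, ∀ v ∈ Q, u ≠ v → ∃ i, i ∈ S u ∧ i ∈ S v

/-- The pseudorandomness properties of the label choices that force the label representation to
be determined by the intersection graph. -/
structure Typical (S : V → Set M) (N ρ : ℝ) (d : ℕ) : Prop where
  card_members_le : ∀ i, (#(members S i) : ℝ) ≤ 3 * N
  card_members_inter_le : ∀ i j, i ≠ j →
    32 * (d : ℝ) ^ 11 * #(members S i ∩ members S j) ≤ N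
  le_card_privateNeighbors : ∀ w i, ρ * N ≤ #(privateNeighbors S w i)
  card_common_le : ∀ u v, u ≠ v → #{i | i ∈ S u ∧ i ∈ S v} ≤ d
  exists_not_meets : ∀ A B : Finset V, Disjoint A B → #A = d → #B = d →
    ∃ b ∈ B, ∃ a ∈ A, ∀ i ∈ S a, i ∈ S b → i ∈ sharedLabels S A

omit [Fintype M] in
theorem mem_members {i : M} {v : V} : v ∈ members S i ↔ i ∈ S v := by simp [members]

theorem mem_privateNeighbors {w x : V} {i : M} : x ∈ privateNeighbors S w i ↔
    x ≠ w ∧ i ∈ S x ∧ ∀ j ∈ S x, j ∈ S w → j = i := by simp [privateNeighbors]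

omit [Fintype V] in
theorem mem_sharedLabels {A : Finset V} {i : M} : i ∈ sharedLabels S A ↔
    ∃ a ∈ A, ∃ b ∈ A, a ≠ b ∧ i ∈ S a ∧ i ∈ S b := by simp [sharedLabels]

theorem mem_privatePairs {i : M} {e : V × V} : e ∈ privatePairs S i ↔
    i ∈ S e.1 ∧ e.2 ∈ privateNeighbors S e.1 i := by simp [privatePairs]

theorem Typical.card_sharedLabels_le (h : Typical S N ρ d) {A : Finset V} (hA : #A = d) :
    #(sharedLabels S A) ≤ d ^ 3 := by
  have h1 : sharedLabels S A ⊆ A.biUnion fun a => (A.filter (a ≠ ·)).biUnion fun b =>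
      {i | i ∈ S a ∧ i ∈ S b} := by
    intro i hi
    obtain ⟨a, ha, b, hb, hab, hi⟩ := mem_sharedLabels.1 hi
    simp only [Finset.mem_biUnion, Finset.mem_filter, Finset.mem_univ, true_and]
    exact ⟨a, ha, b, ⟨hb, hab⟩, hi⟩
  calc _ ≤ _ := Finset.card_le_card h1
    _ ≤ #A * (d * d) := by
        refine Finset.card_biUnion_le_card_mul _ _ _ fun a _ => ?_
        refine (Finset.card_biUnion_le_card_mul _ _ d fun b hb => ?_).trans
          (Nat.mul_le_mul_right _ ((Finset.card_filter_le _ _).trans hA.le))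
        exact h.card_common_le a b (Finset.mem_filter.1 hb).2
    _ = d ^ 3 := by rw [hA]; ring

/-- Any `d` vertices of a clique have shared labels that cover nearly all of the clique. -/
theorem Typical.card_sdiff_biUnion_lt (h : Typical S N ρ d) {Q A : Finset V}
    (hQ : IsLabelClique S Q) (hAQ : A ⊆ Q) (hA : #A = d) :
    #(Q \ (sharedLabels S A).biUnion (members S)) < 2 * d := by
  by_contra! hlt
  have h1 : d ≤ #((Q \ (sharedLabels S A).biUnion (members S)) \ A) := by
    have := Finset.le_card_sdiff A (Q \ (sharedLabels S A).biUnion (members S))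
    omega
  obtain ⟨B, hB, hBd⟩ := Finset.exists_subset_card_eq h1
  have hdisj : Disjoint A B := Finset.disjoint_left.2 fun a ha hb =>
    (Finset.mem_sdiff.1 (hB hb)).2 ha
  obtain ⟨b, hb, a, ha, hab⟩ := h.exists_not_meets A B hdisj hA hBd
  have hb1 := (Finset.mem_sdiff.1 (hB hb)).1
  obtain ⟨hbQ, hb2⟩ := Finset.mem_sdiff.1 hb1
  obtain ⟨i, hia, hib⟩ := hQ a (hAQ ha) b hbQ fun e => Finset.disjoint_left.1 hdisj ha (e ▸ hb)
  exact hb2 (Finset.mem_biUnion.2 ⟨i, hab i hia hib, mem_members.2 hib⟩)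

/-- Pigeonhole: at most `d ^ 3` shared labels cover all but fewer than `2 * d` vertices of the
clique, so one of them takes a `d ^ 3`-th of the covered part. -/
theorem Typical.exists_large_label (h : Typical S N ρ d) {Q : Finset V}
    (hQ : IsLabelClique S Q) (hd : 2 * d ≤ #Q) :
    ∃ i, #Q ≤ 2 * d + d ^ 3 * #(Q ∩ members S i) := by
  obtain ⟨A, hAQ, hA⟩ := Finset.exists_subset_card_eq (show d ≤ #Q by omega)
  have h1 := h.card_sdiff_biUnion_lt hQ hAQ hA
  have hne : (sharedLabels S A).Nonempty := by
    rw [Finset.nonempty_iff_ne_empty]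
    intro h0
    rw [h0] at h1
    simp at h1
    omega
  obtain ⟨i, -, hi⟩ := Finset.exists_max_image (sharedLabels S A)
    (fun i => #(Q ∩ members S i)) hne
  refine ⟨i, ?_⟩
  have h2 : #(Q ∩ (sharedLabels S A).biUnion (members S)) ≤
      #(sharedLabels S A) * #(Q ∩ members S i) := by
    rw [Finset.inter_biUnion]
    exact Finset.card_biUnion_le_card_mul _ _ _ hi
  have h3 := Finset.card_sdiff_add_card_inter Q ((sharedLabels S A).biUnion (members S))
  have h4 := Nat.mul_le_mul_right #(Q ∩ members S i) (h.card_sharedLabels_le hA)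
  omega

/-- A Bonferroni inequality. -/
theorem sum_card_le_card_biUnion_add {κ α : Type*} (J : Finset κ) (F : κ → Finset α) :
    ∑ j ∈ J, #(F j) ≤ #(J.biUnion F) + ∑ j ∈ J, ∑ k ∈ J with k ≠ j, #(F j ∩ F k) := by
  induction J using Finset.induction_on with
  | empty => simp
  | insert a J ha ih =>
    rw [Finset.sum_insert ha, Finset.sum_insert ha, Finset.biUnion_insert]
    have h1 := Finset.card_union_add_card_inter (F a) (J.biUnion F)
    have h2 : #(F a ∩ J.biUnion F) ≤ ∑ k ∈ insert a J with k ≠ a, #(F a ∩ F k) := by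
      rw [Finset.inter_biUnion]
      refine Finset.card_biUnion_le.trans (Finset.sum_le_sum_of_subset fun k hk => ?_)
      simp only [Finset.mem_filter, Finset.mem_insert]
      exact ⟨.inr hk, fun e => ha (e ▸ hk)⟩
    have h3 : ∑ j ∈ J, ∑ k ∈ J with k ≠ j, #(F j ∩ F k) ≤
        ∑ j ∈ J, ∑ k ∈ insert a J with k ≠ j, #(F j ∩ F k) :=
      Finset.sum_le_sum fun j _ => Finset.sum_le_sum_of_subset
        (Finset.filter_subset_filter _ (Finset.subset_insert _ _))
    omega

/-- Large labels overlap little, so they cannot all fit in `Q`. With `8 * d ^ 7` of them the sizes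
add up to at least `8 * d ^ 3 * N`, whereas Bonferroni allows `4 * d ^ 3 * N` for the union and, by
`card_members_inter_le`, `2 * d ^ 3 * N` for the overlaps. -/
theorem Typical.card_large_labels_lt (h : Typical S N ρ d) (hd : 0 < d) (hN : 0 < N)
    {Q : Finset V} (hQ : (#Q : ℝ) ≤ 4 * d ^ 3 * N) {J : Finset M}
    (hJ : ∀ j ∈ J, N ≤ d ^ 4 * #(Q ∩ members S j)) : #J < 8 * d ^ 7 := by
  by_contra! hlt
  obtain ⟨K, hKJ, hK⟩ := Finset.exists_subset_card_eq hlt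
  have hd' : (0 : ℝ) < d := by exact_mod_cast hd
  have h1 : ((∑ j ∈ K, #(Q ∩ members S j) : ℕ) : ℝ) ≤
      #(K.biUnion fun j => Q ∩ members S j) +
        ∑ j ∈ K, ∑ k ∈ K with k ≠ j, (#((Q ∩ members S j) ∩ (Q ∩ members S k)) : ℝ) := by
    exact_mod_cast sum_card_le_card_biUnion_add K fun j => Q ∩ members S j
  have h2 : (#(K.biUnion fun j => Q ∩ members S j) : ℝ) ≤ 4 * d ^ 3 * N := by
    refine le_trans ?_ hQ
    exact_mod_cast Finset.card_le_card
      (Finset.biUnion_subset.2 fun j _ => Finset.inter_subset_left)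
  have h3 : ∑ j ∈ K, ∑ k ∈ K with k ≠ j, (#((Q ∩ members S j) ∩ (Q ∩ members S k)) : ℝ) ≤
      (8 * d ^ 7) * ((8 * d ^ 7) * (N / (32 * d ^ 11))) := by
    have hK' : (#K : ℝ) = 8 * d ^ 7 := by rw [hK]; push_cast; ring
    rw [← hK', ← nsmul_eq_mul]
    refine Finset.sum_le_card_nsmul _ _ _ fun j _ => ?_
    calc _ ≤ #(K.filter (· ≠ j)) • (N / (32 * (d : ℝ) ^ 11)) := by
          refine Finset.sum_le_card_nsmul _ _ _ fun k hk => ?_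
          rw [le_div_iff₀ (by positivity), mul_comm]
          refine le_trans ?_ (h.card_members_inter_le j k (Finset.mem_filter.1 hk).2.symm)
          gcongr
          · exact Finset.inter_subset_right
          · exact Finset.inter_subset_right
      _ ≤ _ := by
          rw [nsmul_eq_mul]
          gcongr
          exact Finset.filter_subset _ _
  have h4 : (8 * d ^ 7 : ℝ) * (N / d ^ 4) ≤ ((∑ j ∈ K, #(Q ∩ members S j) : ℕ) : ℝ) := by
    have hK' : (#K : ℝ) = 8 * d ^ 7 := by rw [hK]; push_cast; ring
    rw [← hK', ← nsmul_eq_mul]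
    push_cast
    refine Finset.card_nsmul_le_sum _ _ _ fun j hj => ?_
    rw [div_le_iff₀ (by positivity), mul_comm]
    exact hJ j (hKJ hj)
  have h5 : (8 * d ^ 7 : ℝ) * (N / d ^ 4) = 8 * (d ^ 3 * N) := by field_simp
  have h6 : (8 * d ^ 7 : ℝ) * ((8 * d ^ 7) * (N / (32 * d ^ 11))) = 2 * (d ^ 3 * N) := by
    field_simp; norm_num
  have h7 : (0 : ℝ) < d ^ 3 * N := by positivity
  linarith

/-- The parameters for which typical label choices are analysed. -/
structure Admissible (N ρ : ℝ) (d : ℕ) : Prop where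
  pos : 0 < ρ
  le_one : ρ ≤ 1
  le_d : 1000 ≤ ρ ^ 4 * d
  le_N : 100 * (d : ℝ) ^ 13 ≤ N

theorem Admissible.thousand_le (a : Admissible N ρ d) : (1000 : ℝ) ≤ d := by
  have := a.le_d
  have h1 : ρ ^ 4 ≤ 1 := pow_le_one₀ a.pos.le a.le_one
  nlinarith [(Nat.cast_nonneg d : (0 : ℝ) ≤ d)]

theorem Admissible.thousand_le_mul (a : Admissible N ρ d) : (1000 : ℝ) ≤ ρ * d := by
  refine a.le_d.trans ?_
  gcongr
  exact pow_le_of_le_one a.pos.le a.le_one (by norm_num)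

theorem Admissible.pow_le (a : Admissible N ρ d) {k : ℕ} (hk : k ≤ 13) :
    100 * (d : ℝ) ^ k ≤ N := by
  refine le_trans ?_ a.le_N
  have := a.thousand_le
  gcongr
  linarith

/-- A large clique lies almost entirely in a single label. -/
theorem Typical.exists_card_sdiff_members_le (h : Typical S N ρ d) (a : Admissible N ρ d)
    {Q : Finset V} (hQ : IsLabelClique S Q) (hQN : ρ * N ≤ #Q) :
    ∃ i, (#(Q \ members S i) : ℝ) ≤ 2 * d + N / d := by
  have hd := a.thousand_le
  have hd0 : (0 : ℝ) < d := by linarith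
  have hd1 : 0 < d := by exact_mod_cast hd0
  have hρd := a.thousand_le_mul
  have hN1 : 100 * (d : ℝ) ≤ N := by simpa using a.pow_le (k := 1) (by norm_num)
  have hN2 := a.pow_le (k := 2) (by norm_num)
  have hN5 := a.pow_le (k := 5) (by norm_num)
  have hN0 : 0 < N := by linarith
  have hdQ : 2 * d ≤ #Q := by
    have : (2 * d : ℝ) ≤ #Q := by
      refine le_trans ?_ hQN
      have : 1000 * N ≤ d * (ρ * N) := by nlinarith
      by_contra! hlt
      nlinarith
    exact_mod_cast this
  obtain ⟨i, hi⟩ := h.exists_large_label hQ hdQ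
  have hi' : (#Q : ℝ) ≤ 2 * d + d ^ 3 * #(Q ∩ members S i) := by exact_mod_cast hi
  refine ⟨i, ?_⟩
  have hQ4 : (#Q : ℝ) ≤ 4 * d ^ 3 * N := by
    have h1 : (#(Q ∩ members S i) : ℝ) ≤ 3 * N := by
      refine le_trans ?_ (h.card_members_le i)
      gcongr
      exact Finset.inter_subset_right
    have h2 : (d ^ 3 : ℝ) * #(Q ∩ members S i) ≤ d ^ 3 * (3 * N) := by gcongr
    have h3 : 1 * N ≤ d ^ 3 * N := by
      gcongr
      exact one_le_pow₀ (by linarith)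
    nlinarith
  -- The other labels that occupy a substantial part of `Q`. They cover little of `Q ∩ L_i`, so a
  -- second sample `A` can be taken there away from all of them. Every label shared within `A`,
  -- apart from `i`, is then small on `Q`, and `d ^ 3` small labels cover at most `N / d` vertices.
  let J : Finset M := {j | j ≠ i ∧ N ≤ d ^ 4 * #(Q ∩ members S j)}
  have hJ : #J < 8 * d ^ 7 := h.card_large_labels_lt hd1 hN0 hQ4 fun j hj =>
    (Finset.mem_filter.1 hj).2.2
  have hX : d ≤ #((Q ∩ members S i) \ J.biUnion (members S)) := by
    have h1 : (#((Q ∩ members S i) ∩ J.biUnion (members S)) : ℝ) ≤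
        8 * d ^ 7 * (N / (32 * d ^ 11)) := by
      rw [Finset.inter_biUnion]
      calc _ ≤ ∑ j ∈ J, (#((Q ∩ members S i) ∩ members S j) : ℝ) := by
            exact_mod_cast Finset.card_biUnion_le
        _ ≤ #J • (N / (32 * (d : ℝ) ^ 11)) := by
            refine Finset.sum_le_card_nsmul _ _ _ fun k hk => ?_
            rw [le_div_iff₀ (by positivity), mul_comm]
            refine le_trans ?_
              (h.card_members_inter_le i k (Finset.mem_filter.1 hk).2.1.symm)
            gcongr
            exact Finset.inter_subset_right
        _ ≤ _ := by
            rw [nsmul_eq_mul]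
            gcongr
            exact_mod_cast hJ.le
    have h2 : (8 * d ^ 7 * (N / (32 * d ^ 11)) : ℝ) = N / d ^ 4 / 4 := by
      field_simp; norm_num
    have h3 : (#((Q ∩ members S i) \ J.biUnion (members S)) : ℝ) +
        #((Q ∩ members S i) ∩ J.biUnion (members S)) = #(Q ∩ members S i) := by
      exact_mod_cast Finset.card_sdiff_add_card_inter _ _
    have h4 : (d ^ 4 : ℝ) * (N / d ^ 4) = N := by field_simp
    have h5 : (d : ℝ) ^ 4 * d ≤ d ^ 4 * #((Q ∩ members S i) \ J.biUnion (members S)) := by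
      have h6 : d * (ρ * N) ≤ d * (2 * d) + d ^ 4 * (#(Q ∩ members S i) : ℝ) := by
        have := mul_le_mul_of_nonneg_left (hQN.trans hi') hd0.le
        nlinarith
      have h7 : 1000 * N ≤ d * (ρ * N) := by nlinarith
      have h8 : (d ^ 4 : ℝ) * #((Q ∩ members S i) ∩ J.biUnion (members S)) ≤ N / 4 := by
        calc _ ≤ (d ^ 4 : ℝ) * (N / d ^ 4 / 4) := by rw [← h2]; gcongr
          _ = _ := by field_simp
      have h9 := congrArg ((d : ℝ) ^ 4 * ·) h3
      simp only [mul_add] at h9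
      nlinarith
    have h6 := le_of_mul_le_mul_left h5 (by positivity)
    exact_mod_cast h6
  obtain ⟨A, hAX, hA⟩ := Finset.exists_subset_card_eq hX
  have hAQ : A ⊆ Q := fun x hx =>
    (Finset.mem_inter.1 (Finset.mem_sdiff.1 (hAX hx)).1).1
  have hcov := h.card_sdiff_biUnion_lt hQ hAQ hA
  have hsub : Q \ members S i ⊆ (Q \ (sharedLabels S A).biUnion (members S)) ∪
      ((sharedLabels S A).filter (· ≠ i)).biUnion fun j => Q ∩ members S j := by
    intro x hx
    obtain ⟨hxQ, hxi⟩ := Finset.mem_sdiff.1 hx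
    by_cases hc : x ∈ (sharedLabels S A).biUnion (members S)
    · obtain ⟨j, hj, hxj⟩ := Finset.mem_biUnion.1 hc
      refine Finset.mem_union_right _ (Finset.mem_biUnion.2 ⟨j, ?_, Finset.mem_inter.2 ⟨hxQ, hxj⟩⟩)
      exact Finset.mem_filter.2 ⟨hj, fun e => hxi (e ▸ hxj)⟩
    · exact Finset.mem_union_left _ (Finset.mem_sdiff.2 ⟨hxQ, hc⟩)
  have hsmall : ∀ j ∈ (sharedLabels S A).filter (· ≠ i),
      (#(Q ∩ members S j) : ℝ) ≤ N / d ^ 4 := by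
    intro j hj
    obtain ⟨hjA, hji⟩ := Finset.mem_filter.1 hj
    by_contra! hlt
    rw [div_lt_iff₀ (by positivity), mul_comm] at hlt
    obtain ⟨x, hx, -, -, -, hjx, -⟩ := mem_sharedLabels.1 hjA
    refine (Finset.mem_sdiff.1 (hAX hx)).2 (Finset.mem_biUnion.2 ⟨j, ?_, mem_members.2 hjx⟩)
    exact Finset.mem_filter.2 ⟨Finset.mem_univ _, hji, hlt.le⟩
  calc (#(Q \ members S i) : ℝ)
      ≤ #(Q \ (sharedLabels S A).biUnion (members S)) +
        #(((sharedLabels S A).filter (· ≠ i)).biUnion fun j => Q ∩ members S j) := by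
        exact_mod_cast (Finset.card_le_card hsub).trans (Finset.card_union_le _ _)
    _ ≤ 2 * d + d ^ 3 * (N / d ^ 4) := by
        gcongr
        · exact_mod_cast hcov.le
        · calc _ ≤ ∑ j ∈ (sharedLabels S A).filter (· ≠ i), (#(Q ∩ members S j) : ℝ) := by
                exact_mod_cast Finset.card_biUnion_le
            _ ≤ #((sharedLabels S A).filter (· ≠ i)) • (N / (d : ℝ) ^ 4) :=
                Finset.sum_le_card_nsmul _ _ _ hsmall
            _ ≤ _ := by
                rw [nsmul_eq_mul]
                gcongr
                exact_mod_cast (Finset.card_filter_le _ _).trans (h.card_sharedLabels_le hA)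
    _ = 2 * d + N / d := by field_simp

end Typical

/-! ### Clique weights and uniqueness of the representation -/

section Reconstruction

variable {V M : Type*} [Fintype V] [Fintype M] {S T : V → Set M} {N ρ : ℝ} {d : ℕ}

theorem pairwiseDisjoint_privatePairs (S : V → Set M) (J : Set M) :
    J.PairwiseDisjoint (privatePairs S) := by
  intro i _ j _ hij
  refine Finset.disjoint_left.2 fun e hi hj => hij ?_
  obtain ⟨hi1, hi⟩ := mem_privatePairs.1 hi
  obtain ⟨-, hj⟩ := mem_privatePairs.1 hj
  exact (mem_privateNeighbors.1 hj).2.2 i (mem_privateNeighbors.1 hi).2.1 hi1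

/-- The private pairs of the label `i` that lie in `Q`. -/
noncomputable def privatePairsIn (S : V → Set M) (Q : Finset V) (i : M) : Finset (V × V) :=
  {e ∈ privatePairs S i | e.1 ∈ Q ∧ e.2 ∈ Q}

/-- The weight of a set of vertices: every private pair of the label `i` contributes the
reciprocal of the number of such pairs. -/
noncomputable def cliqueWeight (S : V → Set M) (Q : Finset V) : ℝ :=
  ∑ i, (#(privatePairsIn S Q i) : ℝ) / #(privatePairs S i)

theorem mem_privatePairsIn {Q : Finset V} {i : M} {e : V × V} :
    e ∈ privatePairsIn S Q i ↔ e ∈ privatePairs S i ∧ e.1 ∈ Q ∧ e.2 ∈ Q := by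
  simp [privatePairsIn]

theorem privatePairsIn_subset (Q : Finset V) (i : M) :
    privatePairsIn S Q i ⊆ privatePairs S i := Finset.filter_subset _ _

theorem Typical.le_card_members (h : Typical S N ρ d) [Nonempty V] (i : M) :
    ρ * N ≤ #(members S i) := by
  refine (h.le_card_privateNeighbors (Classical.arbitrary V) i).trans ?_
  gcongr
  exact fun x hx => mem_members.2 (mem_privateNeighbors.1 hx).2.1

/-- Counts pairs by their first entry. It is applied with `B` all of `L_i`, to bound the private
pairs from below, and with `B` the private neighbours of a vertex outside `L_i`, to bound those that
a clique misses. -/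
theorem card_sigma_privateNeighbors_le {B : Finset V} {i : M} (c : ℝ)
    (hB : ∀ x ∈ B, c ≤ #(privateNeighbors S x i)) :
    #B * c ≤ #((Finset.univ : Finset (V × V)).filter
      fun e => e.1 ∈ B ∧ e.2 ∈ privateNeighbors S e.1 i) := by
  have h1 : #((Finset.univ : Finset (V × V)).filter
      fun e => e.1 ∈ B ∧ e.2 ∈ privateNeighbors S e.1 i) =
      ∑ x ∈ B, #(privateNeighbors S x i) := by
    rw [← Finset.card_sigma]
    refine Finset.card_nbij' (fun e => ⟨e.1, e.2⟩) (fun e => (e.1, e.2)) ?_ ?_ ?_ ?_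
    · intro e he; simpa using he
    · intro e he; simpa using he
    · intro e _; rfl
    · intro e _; rfl
  rw [h1, ← nsmul_eq_mul]
  push_cast
  exact Finset.card_nsmul_le_sum _ _ _ hB

theorem Typical.le_card_privatePairs (h : Typical S N ρ d) (hN : 0 ≤ ρ * N) [Nonempty V] (i : M) :
    (ρ * N) ^ 2 ≤ #(privatePairs S i) := by
  have h1 := card_sigma_privateNeighbors_le (S := S) (B := members S i) (i := i) (ρ * N)
    fun x _ => h.le_card_privateNeighbors x i
  calc _ = (ρ * N) * (ρ * N) := sq _
    _ ≤ #(members S i) * (ρ * N) := by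
        gcongr
        exact h.le_card_members i
    _ ≤ _ := h1
    _ = _ := by
        congr 2
        ext e
        simp [mem_privatePairs, mem_members]

theorem card_privatePairs_le (i : M) : #(privatePairs S i) ≤ #(members S i) ^ 2 := by
  rw [sq, ← Finset.card_product]
  refine Finset.card_le_card fun e he => ?_
  obtain ⟨h1, h2⟩ := mem_privatePairs.1 he
  exact Finset.mem_product.2
    ⟨mem_members.2 h1, mem_members.2 (mem_privateNeighbors.1 h2).2.1⟩

/-- A large part of the private pairs of `i` is missed by a clique that contains a vertex
without the label `i`. -/
theorem Typical.card_privatePairsIn_add_le (h : Typical S N ρ d) (hN : 0 ≤ ρ * N) {Q : Finset V}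
    (hQ : IsLabelClique S Q) {i : M} {w : V} (hw : w ∈ Q) (hwi : i ∉ S w) :
    #(privatePairsIn S Q i) + (ρ * N) ^ 2 ≤ #(privatePairs S i) := by
  have h1 := card_sigma_privateNeighbors_le (S := S) (B := privateNeighbors S w i) (i := i) (ρ * N)
    fun x _ => h.le_card_privateNeighbors x i
  have h2 : (ρ * N) ^ 2 ≤ #(privatePairs S i \ privatePairsIn S Q i) := by
    calc _ = (ρ * N) * (ρ * N) := sq _
      _ ≤ #(privateNeighbors S w i) * (ρ * N) := by
          gcongr
          exact h.le_card_privateNeighbors w i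
      _ ≤ _ := h1
      _ ≤ _ := by
          gcongr
          intro e he
          obtain ⟨he1, he2⟩ := (Finset.mem_filter.1 he).2
          obtain ⟨hne, hi, hpriv⟩ := mem_privateNeighbors.1 he1
          refine Finset.mem_sdiff.2 ⟨mem_privatePairs.2 ⟨hi, he2⟩, fun hin => ?_⟩
          -- The vertex `w` lacks `i`, so its private neighbours at `i` share no label with it and
          -- cannot belong to the clique.
          obtain ⟨j, hj1, hj2⟩ := hQ _ (mem_privatePairsIn.1 hin).2.1 w hw hne
          exact hwi (hpriv j hj1 hj2 ▸ hj2)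
  have h3 : (#(privatePairs S i \ privatePairsIn S Q i) : ℝ) + #(privatePairsIn S Q i) =
      #(privatePairs S i) := by
    exact_mod_cast Finset.card_sdiff_add_card_eq_card (privatePairsIn_subset Q i)
  linarith

theorem sum_card_privatePairsIn_le (Q : Finset V) :
    ∑ i, #(privatePairsIn S Q i) ≤ #Q ^ 2 := by
  rw [sq, ← Finset.card_product, ← Finset.card_biUnion]
  · refine Finset.card_le_card (Finset.biUnion_subset.2 fun i _ e he => ?_)
    exact Finset.mem_product.2 (mem_privatePairsIn.1 he).2
  · exact fun i _ j _ hij => Finset.disjoint_of_subset_left (privatePairsIn_subset Q i)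
      (Finset.disjoint_of_subset_right (privatePairsIn_subset Q j)
        (pairwiseDisjoint_privatePairs S Set.univ trivial trivial hij))

/-- A private pair of `j ≠ i` cannot have `i` at both ends, so one of its ends lies in `Q` outside
`L_i`. -/
theorem sum_erase_card_privatePairsIn_le (Q : Finset V) (i : M) :
    ∑ j ∈ Finset.univ.erase i, #(privatePairsIn S Q j) ≤ 2 * (#(Q \ members S i) * #Q) := by
  rw [← Finset.card_biUnion]
  · calc _ ≤ #((Q \ members S i) ×ˢ Q ∪ Q ×ˢ (Q \ members S i)) := by
          refine Finset.card_le_card (Finset.biUnion_subset.2 fun j hj e he => ?_)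
          obtain ⟨hp, h1, h2⟩ := mem_privatePairsIn.1 he
          obtain ⟨-, hp⟩ := mem_privatePairs.1 hp
          have hij := (Finset.mem_erase.1 hj).1
          by_cases h3 : i ∈ S e.1
          · have h4 : i ∉ S e.2 := fun h4 =>
              hij ((mem_privateNeighbors.1 hp).2.2 i h4 h3).symm
            exact Finset.mem_union_right _ (Finset.mem_product.2
              ⟨h1, Finset.mem_sdiff.2 ⟨h2, fun h => h4 (mem_members.1 h)⟩⟩)
          · exact Finset.mem_union_left _ (Finset.mem_product.2
              ⟨Finset.mem_sdiff.2 ⟨h1, fun h => h3 (mem_members.1 h)⟩, h2⟩)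
      _ ≤ _ := by
          refine (Finset.card_union_le _ _).trans (le_of_eq ?_)
          rw [Finset.card_product, Finset.card_product]
          ring
  · exact fun i _ j _ hij => Finset.disjoint_of_subset_left (privatePairsIn_subset Q i)
      (Finset.disjoint_of_subset_right (privatePairsIn_subset Q j)
        (pairwiseDisjoint_privatePairs S Set.univ trivial trivial hij))

/-- Each label has at least `(ρ * N) ^ 2` private pairs, so fewer than `ρ * N` vertices cannot carry
weight 1. A larger clique is concentrated on one `L_i` but leaves it at some vertex; the loss at `i`
then exceeds the gain from all other labels. -/
theorem Typical.cliqueWeight_lt_one (h : Typical S N ρ d) (a : Admissible N ρ d) [Nonempty V]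
    {Q : Finset V} (hQ : IsLabelClique S Q) (hQL : ∀ i, ¬ Q ⊆ members S i) :
    cliqueWeight S Q < 1 := by
  have hd := a.thousand_le
  have hd0 : (0 : ℝ) < d := by linarith
  have hN2 := a.pow_le (k := 2) (by norm_num)
  have hN0 : 0 < N := lt_of_lt_of_le (by positivity) hN2
  have hρ := a.pos
  have hρN : 0 < ρ * N := by positivity
  have hP := h.le_card_privatePairs hρN.le
  have hP0 : ∀ i, (0 : ℝ) < #(privatePairs S i) := fun i => lt_of_lt_of_le (by positivity) (hP i)
  have hterm : ∀ i, (#(privatePairsIn S Q i) : ℝ) / #(privatePairs S i) ≤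
      #(privatePairsIn S Q i) / (ρ * N) ^ 2 := fun i => by
    gcongr
    exact hP i
  by_cases hsmall : #Q < ρ * N
  · calc cliqueWeight S Q ≤ ∑ i, (#(privatePairsIn S Q i) : ℝ) / (ρ * N) ^ 2 :=
          Finset.sum_le_sum fun i _ => hterm i
      _ = ((∑ i, #(privatePairsIn S Q i) : ℕ) : ℝ) / (ρ * N) ^ 2 := by
          rw [← Finset.sum_div]; push_cast; rfl
      _ ≤ (#Q : ℝ) ^ 2 / (ρ * N) ^ 2 := by
          gcongr
          exact_mod_cast sum_card_privatePairsIn_le (S := S) Q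
      _ < 1 := by
          rw [div_lt_one (by positivity)]
          gcongr
  · push Not at hsmall
    obtain ⟨i, hi⟩ := h.exists_card_sdiff_members_le a hQ hsmall
    obtain ⟨w, hw, hwi⟩ := Finset.not_subset.1 (hQL i)
    have hβ : (#(Q \ members S i) : ℝ) ≤ 2 * (N / d) := by
      have : 2 * (d : ℝ) ≤ N / d := by
        rw [le_div_iff₀ hd0]
        nlinarith
      linarith
    have hβN : N / d ≤ N / 1000 := by gcongr
    have hQ4 : (#Q : ℝ) ≤ 4 * N := by
      have h1 : (#(Q \ members S i) : ℝ) + #(Q ∩ members S i) = #Q := by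
        exact_mod_cast Finset.card_sdiff_add_card_inter _ _
      have h2 : (#(Q ∩ members S i) : ℝ) ≤ 3 * N := by
        refine le_trans ?_ (h.card_members_le i)
        gcongr
        exact Finset.inter_subset_right
      linarith
    have h1 := h.card_privatePairsIn_add_le hρN.le hQ hw fun hh => hwi (mem_members.2 hh)
    -- At least `(ρ * N) ^ 2` of the at most `(3 * N) ^ 2` private pairs are lost, a fraction of at
    -- least `ρ ^ 2 / 9`.
    have h2 : (#(privatePairsIn S Q i) : ℝ) / #(privatePairs S i) ≤ 1 - ρ ^ 2 / 9 := by
      rw [div_le_iff₀ (hP0 i)]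
      have h3 : (#(privatePairs S i) : ℝ) ≤ 9 * N ^ 2 := by
        calc (#(privatePairs S i) : ℝ) ≤ (#(members S i) : ℝ) ^ 2 := by
              exact_mod_cast card_privatePairs_le i
          _ ≤ (3 * N) ^ 2 := by gcongr; exact h.card_members_le i
          _ = _ := by ring
      have h4 : ρ ^ 2 / 9 * #(privatePairs S i) ≤ ρ ^ 2 / 9 * (9 * N ^ 2) := by gcongr
      nlinarith
    have h3 : ∑ j ∈ Finset.univ.erase i, (#(privatePairsIn S Q j) : ℝ) / #(privatePairs S j) ≤
        16 / (ρ ^ 2 * d) := by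
      calc _ ≤ ∑ j ∈ Finset.univ.erase i, (#(privatePairsIn S Q j) : ℝ) / (ρ * N) ^ 2 :=
            Finset.sum_le_sum fun j _ => hterm j
        _ = ((∑ j ∈ Finset.univ.erase i, #(privatePairsIn S Q j) : ℕ) : ℝ) / (ρ * N) ^ 2 := by
            rw [← Finset.sum_div]; push_cast; rfl
        _ ≤ (2 * (#(Q \ members S i) * #Q)) / (ρ * N) ^ 2 := by
            gcongr
            exact_mod_cast sum_erase_card_privatePairsIn_le Q i
        _ ≤ (2 * ((2 * (N / d)) * (4 * N))) / (ρ * N) ^ 2 := by gcongr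
        _ = _ := by field_simp; norm_num
    -- This amounts to `144 < ρ ^ 4 * d`, which `Admissible.le_d` supplies.
    have h4 : 16 / (ρ ^ 2 * d) < ρ ^ 2 / 9 := by
      rw [div_lt_div_iff₀ (by positivity) (by norm_num)]
      have := a.le_d
      nlinarith
    rw [cliqueWeight, ← Finset.add_sum_erase _ _ (Finset.mem_univ i)]
    linarith

/-- Inside `L_i` every pair has `i` in common, so only private pairs of `i` count. Weight 1 forces
all of them into `Q`, and every vertex of `L_i` is an end of one. -/
theorem Typical.cliqueWeight_of_subset (h : Typical S N ρ d) (a : Admissible N ρ d) [Nonempty V]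
    {Q : Finset V} {i : M} (hQi : Q ⊆ members S i) :
    cliqueWeight S Q ≤ 1 ∧ (1 ≤ cliqueWeight S Q → Q = members S i) := by
  have hd := a.thousand_le
  have hN2 := a.pow_le (k := 2) (by norm_num)
  have hN0 : 0 < N := lt_of_lt_of_le (by positivity) hN2
  have hρN : 0 < ρ * N := mul_pos a.pos hN0
  have hP0 : (0 : ℝ) < #(privatePairs S i) :=
    lt_of_lt_of_le (by positivity) (h.le_card_privatePairs hρN.le i)
  have h1 : cliqueWeight S Q = (#(privatePairsIn S Q i) : ℝ) / #(privatePairs S i) := by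
    refine Finset.sum_eq_single i (fun j _ hji => ?_) fun hh => absurd (Finset.mem_univ i) hh
    have : privatePairsIn S Q j = ∅ := by
      refine Finset.eq_empty_of_forall_notMem fun e he => hji ?_
      obtain ⟨hp, h1, h2⟩ := mem_privatePairsIn.1 he
      obtain ⟨-, hp⟩ := mem_privatePairs.1 hp
      exact ((mem_privateNeighbors.1 hp).2.2 i (mem_members.1 (hQi h2))
        (mem_members.1 (hQi h1))).symm
    simp [this]
  rw [h1]
  refine ⟨(div_le_one hP0).2 (by exact_mod_cast Finset.card_le_card (privatePairsIn_subset Q i)),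
    fun hle => ?_⟩
  rw [le_div_iff₀ hP0, one_mul] at hle
  have h2 := Finset.eq_of_subset_of_card_le (privatePairsIn_subset Q i) (by exact_mod_cast hle)
  refine hQi.antisymm fun w hw => ?_
  have h3 : (0 : ℝ) < #(privateNeighbors S w i) :=
    lt_of_lt_of_le hρN (h.le_card_privateNeighbors w i)
  obtain ⟨x, hx⟩ := Finset.card_pos.1 (by exact_mod_cast h3)
  have h4 : (w, x) ∈ privatePairsIn S Q i := by
    rw [h2]
    exact mem_privatePairs.2 ⟨mem_members.1 hw, hx⟩
  exact (mem_privatePairsIn.1 h4).2.1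

/-- The label representation of typical label choices is determined by the intersection graph. -/
theorem Typical.eqUpToLabels (h : Typical S N ρ d) (a : Admissible N ρ d)
    (hG : intersectionGraph T = intersectionGraph S) :
    EqUpToLabels (bipartiteGraph S) (bipartiteGraph T) := by
  rw [eqUpToLabels_bipartiteGraph_iff]
  obtain hV | hV := isEmpty_or_nonempty V
  · exact ⟨Equiv.refl _, fun i => Set.ext fun v => hV.elim v⟩
  have hd := a.thousand_le
  have hN2 := a.pow_le (k := 2) (by norm_num)
  have hN0 : 0 < N := lt_of_lt_of_le (by positivity) hN2
  have hρN : 0 < ρ * N := mul_pos a.pos hN0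
  have hP0 : ∀ i, (0 : ℝ) < #(privatePairs S i) := fun i =>
    lt_of_lt_of_le (by positivity) (h.le_card_privatePairs hρN.le i)
  have hclique : ∀ j, IsLabelClique S (members T j) := by
    intro j u hu v hv huv
    have h1 : (intersectionGraph T).Adj u v :=
      ⟨huv, j, mem_members.1 hu, mem_members.1 hv⟩
    rw [hG] at h1
    obtain ⟨-, i, hi⟩ := h1
    exact ⟨i, hi⟩
  have hcover : ∀ i, ∀ e ∈ privatePairs S i, ∃ j, e ∈ privatePairsIn S (members T j) i := by
    intro i e he
    obtain ⟨h1, h2⟩ := mem_privatePairs.1 he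
    obtain ⟨hne, h3, -⟩ := mem_privateNeighbors.1 h2
    have h4 : (intersectionGraph S).Adj e.1 e.2 := ⟨hne.symm, i, h1, h3⟩
    rw [← hG] at h4
    obtain ⟨-, j, hj1, hj2⟩ := h4
    exact ⟨j, mem_privatePairsIn.2 ⟨he, mem_members.2 hj1, mem_members.2 hj2⟩⟩
  have hle : ∀ j, cliqueWeight S (members T j) ≤ 1 := by
    intro j
    by_cases hj : ∃ i, members T j ⊆ members S i
    · obtain ⟨i, hi⟩ := hj
      exact (h.cliqueWeight_of_subset a hi).1
    · push Not at hj
      exact (h.cliqueWeight_lt_one a (hclique j) hj).le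
  -- Exchanging the sums, each label `i` receives at least 1, because its private pairs are edges
  -- and so are all covered by the cliques of `T`.
  have htotal : ∑ _j : M, (1 : ℝ) ≤ ∑ j, cliqueWeight S (members T j) := by
    unfold cliqueWeight
    rw [Finset.sum_comm]
    refine Finset.sum_le_sum fun i _ => ?_
    rw [← Finset.sum_div, le_div_iff₀ (hP0 i), one_mul]
    have h1 : privatePairs S i ⊆
        Finset.univ.biUnion fun j => privatePairsIn S (members T j) i := by
      intro e he
      obtain ⟨j, hj⟩ := hcover i e he
      exact Finset.mem_biUnion.2 ⟨j, Finset.mem_univ _, hj⟩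
    exact_mod_cast (Finset.card_le_card h1).trans Finset.card_biUnion_le
  have heq : ∀ j, cliqueWeight S (members T j) = 1 := by
    have := (Finset.sum_eq_sum_iff_of_le fun j (_ : j ∈ Finset.univ) => hle j).1
      (le_antisymm (Finset.sum_le_sum fun j _ => hle j) htotal)
    exact fun j => this j (Finset.mem_univ j)
  have hex : ∀ j, ∃ i, members T j = members S i := by
    intro j
    by_cases hj : ∃ i, members T j ⊆ members S i
    · obtain ⟨i, hi⟩ := hj
      exact ⟨i, (h.cliqueWeight_of_subset a hi).2 (heq j).ge⟩
    · push Not at hj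
      exact absurd (heq j) (h.cliqueWeight_lt_one a (hclique j) hj).ne
  choose f hf using hex
  -- A private pair of `i` lies in some `members T j`, hence in `L_(f j)`; its only common label
  -- being `i`, this gives `f j = i`.
  have hsurj : Function.Surjective f := by
    intro i
    obtain ⟨e, he⟩ := Finset.card_pos.1 (by exact_mod_cast hP0 i)
    obtain ⟨j, hj⟩ := hcover i e he
    obtain ⟨-, h1, h2⟩ := mem_privatePairsIn.1 hj
    rw [hf j, mem_members] at h1 h2
    exact ⟨j, (mem_privateNeighbors.1 (mem_privatePairs.1 he).2).2.2 _ h2 h1⟩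
  have hbij : Function.Bijective f := Finite.surjective_iff_bijective.1 hsurj
  refine ⟨(Equiv.ofBijective f hbij).symm, fun i => Set.ext fun v => ?_⟩
  have h1 := hf ((Equiv.ofBijective f hbij).symm i)
  have h2 : f ((Equiv.ofBijective f hbij).symm i) = i :=
    (Equiv.ofBijective f hbij).apply_symm_apply i
  rw [h2] at h1
  have h3 := Finset.ext_iff.1 h1 v
  rwa [mem_members, mem_members] at h3

end Reconstruction

/-! ### Probability that the label choices are typical -/

section TypicalProbability

variable {V M : Type*} [Fintype V] [Fintype M] (p : unitInterval) (κ d : ℕ)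

local notation "ℙ" => Measure.pi fun _ : V => setBernoulli (Set.univ : Set M) p

theorem one_sub_coe_nonneg : (0 : ℝ) ≤ 1 - p := sub_nonneg.2 p.2.2

theorem one_sub_coe_le_one : (1 : ℝ) - p ≤ 1 := sub_le_self _ p.2.1

/-- The number of labels of the vertex `v`. -/
noncomputable def labelCount (S : V → Set M) (v : V) : ℕ := #{i | i ∈ S v}

theorem setBernoulli_real_mem (i : M) :
    (setBernoulli (Set.univ : Set M) p).real {s | i ∈ s} = p := by
  have := setBernoulli_univ_real_subset_disjoint p {i} ∅ (Finset.disjoint_empty_right _)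
  simpa using this

theorem setBernoulli_real_mem_mem {i j : M} (hij : i ≠ j) :
    (setBernoulli (Set.univ : Set M) p).real {s | i ∈ s ∧ j ∈ s} = (p : ℝ) ^ 2 := by
  have := setBernoulli_univ_real_subset_disjoint p {i, j} ∅ (Finset.disjoint_empty_right _)
  rw [Finset.card_pair hij] at this
  simpa using this

theorem prob_labelCount_ge (v : V) :
    (ℙ).real {S | κ ≤ labelCount S v} ≤ Real.exp (2 * p * Fintype.card M - κ) := by
  have h := pi_real_forall_mem_le_pow (fun _ : V => setBernoulli (Set.univ : Set M) p) {v}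
    (fun _ => {s | (κ : ℝ) ≤ #{i ∈ Finset.univ | i ∈ s}}) _
    fun _ _ => setBernoulli_univ_real_le_card_inter p Finset.univ κ
  simpa [labelCount] using h

theorem prob_card_members_ge (i : M) (t : ℝ) :
    (ℙ).real {S | t ≤ #(members S i)} ≤ Real.exp (2 * p * Fintype.card V - t) := by
  have h := pi_real_le_card_le_exp (fun _ : V => setBernoulli (Set.univ : Set M) p) Finset.univ
    (fun _ => {s | i ∈ s}) p t fun _ _ => (setBernoulli_real_mem p i).le
  simpa [members] using h

theorem prob_card_members_inter_ge {i j : M} (hij : i ≠ j) (t : ℝ) :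
    (ℙ).real {S | t ≤ #(members S i ∩ members S j)} ≤
      Real.exp (2 * (p : ℝ) ^ 2 * Fintype.card V - t) := by
  have h := pi_real_le_card_le_exp (fun _ : V => setBernoulli (Set.univ : Set M) p) Finset.univ
    (fun _ => {s | i ∈ s ∧ j ∈ s}) _ t fun _ _ => (setBernoulli_real_mem_mem p hij).le
  simpa [members, Finset.filter_and] using h

/-- Given the labels of `w`, the other vertices are independent, and each that has `i` and avoids
the remaining, at most `κ`, labels of `w` is a private neighbour. The bound on `labelCount` is part
of the event, so that conditioning on more than `κ` labels leaves the empty event. -/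
theorem prob_card_privateNeighbors_le (w : V) (i : M) (t : ℝ) :
    (ℙ).real {S | labelCount S w ≤ κ ∧ #(privateNeighbors S w i) ≤ t} ≤
      Real.exp (t - p * (1 - p) ^ κ * ((Fintype.card V : ℝ) - 1) / 2) := by
  refine pi_real_le_of_forall_piecewise _ {w} _ _ fun σ => ?_
  by_cases hσ : labelCount σ w ≤ κ
  · let Y : Finset M := {j | j ∈ σ w ∧ j ≠ i}
    have hY : #Y ≤ κ := le_trans (Finset.card_le_card fun j hj => by
      simp only [Y, Finset.mem_filter] at hj ⊢
      exact ⟨hj.1, hj.2.1⟩) hσ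
    have hU : (p : ℝ) * (1 - p) ^ κ ≤ (setBernoulli (Set.univ : Set M) p).real
        {s | (∀ j ∈ ({i} : Finset M), j ∈ s) ∧ ∀ j ∈ Y, j ∉ s} := by
      rw [setBernoulli_univ_real_subset_disjoint p {i} Y (by simp [Y]), Finset.card_singleton,
        pow_one]
      exact mul_le_mul_of_nonneg_left
        (pow_le_pow_of_le_one (one_sub_coe_nonneg p) (one_sub_coe_le_one p) hY) p.2.1
    have h := pi_real_card_le_le_exp (fun _ : V => setBernoulli (Set.univ : Set M) p)
      (Finset.univ.erase w) (fun _ => {s | (∀ j ∈ ({i} : Finset M), j ∈ s) ∧ ∀ j ∈ Y, j ∉ s})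
      _ t fun _ _ => hU
    have hcard : ((#(Finset.univ.erase w) : ℕ) : ℝ) = (Fintype.card V : ℝ) - 1 := by
      rw [Finset.card_erase_of_mem (Finset.mem_univ w), Nat.cast_sub, Nat.cast_one,
        Finset.card_univ]
      exact Finset.card_pos.2 ⟨w, Finset.mem_univ w⟩
    rw [hcard] at h
    refine le_trans (measureReal_mono ?_) h
    rintro S ⟨-, hS⟩
    refine le_trans ?_ hS
    norm_cast
    refine Finset.card_le_card fun x hx => ?_
    simp only [Finset.mem_filter, Set.mem_ofPred_eq] at hx
    obtain ⟨hx1, hx2, hx3⟩ := hx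
    have hxw := (Finset.mem_erase.1 hx1).1
    rw [mem_privateNeighbors]
    simp only [Finset.mem_singleton, hxw, not_false_eq_true, Finset.piecewise_eq_of_notMem,
      Finset.piecewise_eq_of_mem]
    refine ⟨hxw, hx2 i (Finset.mem_singleton_self i), fun j hj hjw => ?_⟩
    by_contra hji
    exact hx3 j (by simp [Y, hjw, hji]) hj
  · have : {S : V → Set M | ({w} : Finset V).piecewise σ S ∈
        {S | labelCount S w ≤ κ ∧ (#(privateNeighbors S w i) : ℝ) ≤ t}} = ∅ := by
      refine Set.eq_empty_of_forall_notMem fun S hS => hσ ?_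
      simpa [labelCount] using hS.1
    rw [this]
    simpa using (Real.exp_pos _).le

theorem prob_card_common_ge {u v : V} (huv : u ≠ v) :
    (ℙ).real {S | labelCount S u ≤ κ ∧ d ≤ #{i | i ∈ S u ∧ i ∈ S v}} ≤
      Real.exp (2 * p * κ - d) := by
  refine pi_real_le_of_forall_piecewise _ {u} _ _ fun σ => ?_
  by_cases hσ : labelCount σ u ≤ κ
  · have h := pi_real_forall_mem_le_pow (fun _ : V => setBernoulli (Set.univ : Set M) p) {v}
      (fun _ => {s | (d : ℝ) ≤ #{i ∈ ({i | i ∈ σ u} : Finset M) | i ∈ s}}) _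
      fun _ _ => setBernoulli_univ_real_le_card_inter p _ d
    rw [Finset.card_singleton, pow_one] at h
    refine (measureReal_mono ?_).trans (h.trans ?_)
    · rintro S ⟨-, hS⟩ v' hv'
      obtain rfl := Finset.mem_singleton.1 hv'
      simpa [huv.symm, Finset.filter_filter] using hS
    · have : (#({i | i ∈ σ u} : Finset M) : ℝ) ≤ κ := by exact_mod_cast hσ
      have := p.2.1
      gcongr
  · have : {S : V → Set M | ({u} : Finset V).piecewise σ S ∈
        {S | labelCount S u ≤ κ ∧ d ≤ #{i | i ∈ S u ∧ i ∈ S v}}} = ∅ := by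
      refine Set.eq_empty_of_forall_notMem fun S hS => hσ ?_
      simpa [labelCount] using hS.1
    rw [this]
    simpa using (Real.exp_pos _).le

/-- Given the labels of `A`, removing the shared ones leaves pairwise disjoint sets of at most `κ`
labels. For a single `b` the events of meeting them are therefore independent, and different `b` are
independent as well. -/
theorem prob_forall_meets {A B : Finset V} (hAB : Disjoint A B) :
    (ℙ).real {S | (∀ a ∈ A, labelCount S a ≤ κ) ∧
      ∀ b ∈ B, ∀ a ∈ A, ∃ i ∈ S a, i ∈ S b ∧ i ∉ sharedLabels S A} ≤
      ((1 - (1 - (p : ℝ)) ^ κ) ^ #A) ^ #B := by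
  have h0 := one_sub_coe_nonneg p
  have h1 := one_sub_coe_le_one p
  have hq : ∀ k : ℕ, (0 : ℝ) ≤ 1 - (1 - p) ^ k := fun k => sub_nonneg.2 (pow_le_one₀ h0 h1)
  refine pi_real_le_of_forall_piecewise _ A _ _ fun σ => ?_
  by_cases hσ : ∀ a ∈ A, labelCount σ a ≤ κ
  · let X : V → Finset M := fun a => {i | i ∈ σ a ∧ i ∉ sharedLabels σ A}
    have hX : (A : Set V).PairwiseDisjoint X := by
      intro a ha b hb hab
      refine Finset.disjoint_left.2 fun i hia hib => ?_
      simp only [X, Finset.mem_filter, Finset.mem_univ, true_and] at hia hib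
      exact hia.2 (mem_sharedLabels.2 ⟨a, ha, b, hb, hab, hia.1, hib.1⟩)
    have hU : (setBernoulli (Set.univ : Set M) p).real {s | ∀ a ∈ A, ∃ i ∈ X a, i ∈ s} ≤
        (1 - (1 - (p : ℝ)) ^ κ) ^ #A := by
      rw [setBernoulli_univ_real_forall_meets p A X hX, ← Finset.prod_const]
      refine Finset.prod_le_prod (fun a _ => hq _) fun a ha => ?_
      refine sub_le_sub_left (pow_le_pow_of_le_one h0 h1 ?_) _
      refine le_trans (Finset.card_le_card fun j hj => ?_) (hσ a ha)
      simp only [X, Finset.mem_filter] at hj ⊢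
      exact ⟨hj.1, hj.2.1⟩
    refine le_trans (measureReal_mono ?_) (pi_real_forall_mem_le_pow
      (fun _ : V => setBernoulli (Set.univ : Set M) p) B
      (fun _ => {s | ∀ a ∈ A, ∃ i ∈ X a, i ∈ s}) _ fun _ _ => hU)
    rintro S ⟨-, hS⟩ b hb a ha
    have hbA : b ∉ A := fun hbA => Finset.disjoint_left.1 hAB hbA hb
    obtain ⟨i, hia, hib, hi⟩ := hS b hb a ha
    rw [Finset.piecewise_eq_of_mem _ _ _ ha] at hia
    rw [Finset.piecewise_eq_of_notMem _ _ _ hbA] at hib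
    refine ⟨i, ?_, hib⟩
    simp only [X, Finset.mem_filter, Finset.mem_univ, true_and]
    refine ⟨hia, fun hs => hi ?_⟩
    obtain ⟨a, ha, b, hb, hab, hia, hib⟩ := mem_sharedLabels.1 hs
    refine mem_sharedLabels.2 ⟨a, ha, b, hb, hab, ?_, ?_⟩
    · rwa [Finset.piecewise_eq_of_mem _ _ _ ha]
    · rwa [Finset.piecewise_eq_of_mem _ _ _ hb]
  · have : {S : V → Set M | A.piecewise σ S ∈
        {S | (∀ a ∈ A, labelCount S a ≤ κ) ∧
          ∀ b ∈ B, ∀ a ∈ A, ∃ i ∈ S a, i ∈ S b ∧ i ∉ sharedLabels S A}} = ∅ := by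
      refine Set.eq_empty_of_forall_notMem fun S hS => hσ fun a ha => ?_
      simpa [labelCount, ha] using hS.1 a ha
    rw [this]
    simpa using pow_nonneg (pow_nonneg (hq _) _) _

theorem prob_exists_le {Ω : Type*} [MeasurableSpace Ω] (μ : Measure Ω) [IsFiniteMeasure μ]
    {κ : Type*} (s : Finset κ) (E : κ → Set Ω) (c : ℝ) (h : ∀ k ∈ s, μ.real (E k) ≤ c) :
    μ.real {ω | ∃ k ∈ s, ω ∈ E k} ≤ #s * c := by
  have h1 : {ω | ∃ k ∈ s, ω ∈ E k} = ⋃ k ∈ s, E k := by ext; simp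
  rw [h1, ← nsmul_eq_mul]
  exact (measureReal_biUnion_finset_le s E).trans (Finset.sum_le_card_nsmul _ _ _ h)

/-- The probability that the label choices are not typical. -/
theorem prob_not_typical_le (N ρ : ℝ) (hd : 0 < d) :
    (ℙ).real {S | ¬ Typical S N ρ d} ≤
      Fintype.card V * Real.exp (2 * p * Fintype.card M - κ) +
      Fintype.card M * Real.exp (2 * p * Fintype.card V - 3 * N) +
      Fintype.card M ^ 2 *
        Real.exp (2 * (p : ℝ) ^ 2 * Fintype.card V - N / (32 * (d : ℝ) ^ 11)) +
      Fintype.card V * Fintype.card M *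
        Real.exp (ρ * N - p * (1 - p) ^ κ * ((Fintype.card V : ℝ) - 1) / 2) +
      Fintype.card V ^ 2 * Real.exp (2 * p * κ - d) +
      (Fintype.card V : ℝ) ^ (2 * d) * ((1 - (1 - (p : ℝ)) ^ κ) ^ d) ^ d := by
  have hd' : (0 : ℝ) < d := by exact_mod_cast hd
  let E0 : Set (V → Set M) := {S | ∃ v ∈ (Finset.univ : Finset V), S ∈ {S | κ ≤ labelCount S v}}
  let E1 : Set (V → Set M) := {S | ∃ i ∈ (Finset.univ : Finset M),
    S ∈ {S : V → Set M | 3 * N ≤ #(members S i)}}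
  let E2 : Set (V → Set M) := {S | ∃ e ∈ (Finset.univ : Finset M).offDiag,
    S ∈ {S : V → Set M | N / (32 * (d : ℝ) ^ 11) ≤ #(members S e.1 ∩ members S e.2)}}
  let E3 : Set (V → Set M) := {S | ∃ e ∈ (Finset.univ : Finset (V × M)),
    S ∈ {S : V → Set M | labelCount S e.1 ≤ κ ∧ #(privateNeighbors S e.1 e.2) ≤ ρ * N}}
  let E4 : Set (V → Set M) := {S | ∃ e ∈ (Finset.univ : Finset V).offDiag,
    S ∈ {S : V → Set M | labelCount S e.1 ≤ κ ∧ d ≤ #{i | i ∈ S e.1 ∧ i ∈ S e.2}}}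
  let F : Finset (Finset V × Finset V) :=
    {e ∈ Finset.powersetCard d Finset.univ ×ˢ Finset.powersetCard d Finset.univ |
      Disjoint e.1 e.2}
  let E5 : Set (V → Set M) := {S | ∃ e ∈ F,
    S ∈ {S : V → Set M | (∀ a ∈ e.1, labelCount S a ≤ κ) ∧
      ∀ b ∈ e.2, ∀ a ∈ e.1, ∃ i ∈ S a, i ∈ S b ∧ i ∉ sharedLabels S e.1}}
  have hsub : {S : V → Set M | ¬ Typical S N ρ d} ⊆ E0 ∪ E1 ∪ E2 ∪ E3 ∪ E4 ∪ E5 := by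
    intro S hS
    by_contra hE
    simp only [Set.mem_union, not_or] at hE
    obtain ⟨⟨⟨⟨⟨h0, h1⟩, h2⟩, h3⟩, h4⟩, h5⟩ := hE
    have hc : ∀ v, labelCount S v ≤ κ := fun v => by
      by_contra hv
      exact h0 ⟨v, Finset.mem_univ v, (not_le.1 hv).le⟩
    refine hS ⟨fun i => ?_, fun i j hij => ?_, fun w i => ?_, fun u v huv => ?_,
      fun A B hAB hA hB => ?_⟩
    · by_contra hv
      exact h1 ⟨i, Finset.mem_univ i, (not_le.1 hv).le⟩
    · by_contra hv
      refine h2 ⟨(i, j), by simpa using hij, ?_⟩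
      change N / (32 * (d : ℝ) ^ 11) ≤ #(members S i ∩ members S j)
      rw [div_le_iff₀ (by positivity), mul_comm]
      exact (not_le.1 hv).le
    · by_contra hv
      exact h3 ⟨(w, i), Finset.mem_univ _, hc w, (not_le.1 hv).le⟩
    · by_contra hv
      exact h4 ⟨(u, v), by simpa using huv, hc u, (not_le.1 hv).le⟩
    · by_contra! hv
      refine h5 ⟨(A, B), ?_, fun a _ => hc a, hv⟩
      simp [F, hA, hB, hAB]
  have b0 : (ℙ).real E0 ≤ Fintype.card V * Real.exp (2 * p * Fintype.card M - κ) :=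
    prob_exists_le _ _ _ _ fun v _ => prob_labelCount_ge p κ v
  have b1 : (ℙ).real E1 ≤ Fintype.card M * Real.exp (2 * p * Fintype.card V - 3 * N) :=
    prob_exists_le _ _ _ _ fun i _ => prob_card_members_ge p i (3 * N)
  have b2 : (ℙ).real E2 ≤ Fintype.card M ^ 2 *
      Real.exp (2 * (p : ℝ) ^ 2 * Fintype.card V - N / (32 * (d : ℝ) ^ 11)) := by
    refine (prob_exists_le _ _ _ _ fun e he => prob_card_members_inter_ge p
      (Finset.mem_offDiag.1 he).2.2 _).trans ?_
    gcongr
    rw [sq]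
    exact_mod_cast (Finset.card_le_card (Finset.subset_univ _)).trans (by simp)
  have b3 : (ℙ).real E3 ≤ Fintype.card V * Fintype.card M *
      Real.exp (ρ * N - p * (1 - p) ^ κ * ((Fintype.card V : ℝ) - 1) / 2) := by
    refine (prob_exists_le _ _ _ _ fun e _ =>
      prob_card_privateNeighbors_le p κ e.1 e.2 (ρ * N)).trans (le_of_eq ?_)
    simp
  have b4 : (ℙ).real E4 ≤ Fintype.card V ^ 2 * Real.exp (2 * p * κ - d) := by
    refine (prob_exists_le _ _ _ _ fun e he => prob_card_common_ge p κ d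
      (Finset.mem_offDiag.1 he).2.2).trans ?_
    gcongr
    rw [sq]
    exact_mod_cast (Finset.card_le_card (Finset.subset_univ _)).trans (by simp)
  have b5 : (ℙ).real E5 ≤ (Fintype.card V : ℝ) ^ (2 * d) *
      ((1 - (1 - (p : ℝ)) ^ κ) ^ d) ^ d := by
    refine (prob_exists_le _ F _ (((1 - (1 - (p : ℝ)) ^ κ) ^ d) ^ d) fun e he => ?_).trans ?_
    · simp only [F, Finset.mem_filter, Finset.mem_product, Finset.mem_powersetCard] at he
      have h := prob_forall_meets (M := M) p κ he.2
      rwa [he.1.1.2, he.1.2.2] at h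
    · refine mul_le_mul_of_nonneg_right ?_ (pow_nonneg (pow_nonneg (sub_nonneg.2
        (pow_le_one₀ (one_sub_coe_nonneg p) (one_sub_coe_le_one p))) _) _)
      have : #F ≤ Fintype.card V ^ d * Fintype.card V ^ d := by
        refine (Finset.card_filter_le _ _).trans ?_
        rw [Finset.card_product, Finset.card_powersetCard, Finset.card_univ]
        exact Nat.mul_le_mul (Nat.choose_le_pow _ _) (Nat.choose_le_pow _ _)
      rw [two_mul, pow_add]
      exact_mod_cast this
  calc (ℙ).real {S | ¬ Typical S N ρ d} ≤ (ℙ).real (E0 ∪ E1 ∪ E2 ∪ E3 ∪ E4 ∪ E5) :=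
        measureReal_mono hsub
    _ ≤ _ := by
        refine (measureReal_union_le _ _).trans (add_le_add ?_ b5)
        refine (measureReal_union_le _ _).trans (add_le_add ?_ b4)
        refine (measureReal_union_le _ _).trans (add_le_add ?_ b3)
        refine (measureReal_union_le _ _).trans (add_le_add ?_ b2)
        exact (measureReal_union_le _ _).trans (add_le_add b0 b1)

end TypicalProbability

/-! ### Choice of parameters and the limit -/

/-- With `N = n * p` and `ρ = θ / 8`, each of the six error terms is at most `n ^ 2 * exp (-d)`,
except that common labels cost the extra factor `exp (2 * K)`. -/
theorem labelLaw_real_not_typical_le {n m κ d : ℕ} {p : unitInterval} {θ K : ℝ} (hn : 2 ≤ n)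
    (hmn : m ≤ n) (hd : 0 < d) (hθ : 0 < θ) (hθκ : θ ≤ (1 - (p : ℝ)) ^ κ)
    (hκ : 2 * (p : ℝ) * m + d ≤ κ) (hpd : 128 * (p : ℝ) * d ^ 11 ≤ 1)
    (hN : 64 * (d : ℝ) ^ 12 ≤ n * p) (hdN : (d : ℝ) ≤ θ / 8 * (n * p)) (hK : (p : ℝ) * κ ≤ K)
    (hlog : 2 * Real.log n + 1 ≤ θ * d) :
    (labelLaw n m p).real {S | ¬ Typical S (n * p) (θ / 8) d} ≤
      6 * Real.exp (2 * K) * (n ^ 2 * Real.exp (-d)) := by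
  have h := prob_not_typical_le (V := Fin n) (M := Fin m) p κ d (n * p) (θ / 8) hd
  rw [Fintype.card_fin, Fintype.card_fin] at h
  have hp0 : (0 : ℝ) ≤ p := p.2.1
  have hn1 : (2 : ℝ) ≤ n := by exact_mod_cast hn
  have hm1 : (m : ℝ) ≤ n := by exact_mod_cast hmn
  have hd1 : (1 : ℝ) ≤ d := by exact_mod_cast hd
  have hn0 : (0 : ℝ) < n := by linarith
  have hnn : (n : ℝ) ≤ n ^ 2 := le_self_pow₀ (by linarith) (by norm_num)
  have hnp : (0 : ℝ) ≤ n * p := by positivity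
  have hθ1 : θ ≤ 1 := hθκ.trans (pow_le_one₀ (one_sub_coe_nonneg p) (one_sub_coe_le_one p))
  have hK0 : 0 ≤ K := le_trans (by positivity) hK
  have hdnp : (d : ℝ) ≤ n * p := hdN.trans (mul_le_of_le_one_left hnp (by linarith))
  have b0 : n * Real.exp (2 * p * m - κ) ≤ n ^ 2 * Real.exp (-d) := by
    gcongr
    linarith
  have b1 : m * Real.exp (2 * p * n - 3 * (n * p)) ≤ n ^ 2 * Real.exp (-d) := by
    refine mul_le_mul (hm1.trans hnn) (Real.exp_le_exp.2 ?_) (by positivity) (by positivity)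
    linarith
  have b2 : m ^ 2 * Real.exp (2 * (p : ℝ) ^ 2 * n - n * p / (32 * (d : ℝ) ^ 11)) ≤
      n ^ 2 * Real.exp (-d) := by
    gcongr
    have h1 : (p : ℝ) ≤ 1 / (128 * d ^ 11) := by
      rw [le_div_iff₀ (by positivity)]
      linarith
    have h2 : 2 * (p : ℝ) ^ 2 * n ≤ 2 * (n * p) * (1 / (128 * d ^ 11)) := by
      calc 2 * (p : ℝ) ^ 2 * n = 2 * (n * p) * p := by ring
        _ ≤ _ := by gcongr
    have h3 : 2 * (n * (p : ℝ)) * (1 / (128 * (d : ℝ) ^ 11)) = n * p / (64 * d ^ 11) := by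
      field_simp; ring
    have h4 : n * (p : ℝ) / (32 * (d : ℝ) ^ 11) = 2 * (n * p / (64 * (d : ℝ) ^ 11)) := by
      field_simp; ring
    have h5 : (d : ℝ) ≤ n * (p : ℝ) / (64 * (d : ℝ) ^ 11) := by
      rw [le_div_iff₀ (by positivity)]
      calc _ = 64 * (d : ℝ) ^ 12 := by ring
        _ ≤ _ := hN
    linarith
  have b3 : n * m * Real.exp (θ / 8 * (n * p) - p * (1 - p) ^ κ * ((n : ℝ) - 1) / 2) ≤
      n ^ 2 * Real.exp (-d) := by
    rw [sq]
    gcongr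
    -- The tail bound subtracts half the mean, at least `p * θ * n / 4`, which is twice the
    -- threshold `θ / 8 * (n * p)`; the surplus is at least `d`.
    have h1 : p * θ * (n / 2) ≤ p * (1 - (p : ℝ)) ^ κ * ((n : ℝ) - 1) := by
      gcongr
      · exact mul_nonneg hp0 (hθ.le.trans hθκ)
      · linarith
    have h2 : p * θ * ((n : ℝ) / 2) = 4 * (θ / 8 * (n * p)) := by ring
    linarith
  have b4 : n ^ 2 * Real.exp (2 * p * κ - d) ≤
      Real.exp (2 * K) * (n ^ 2 * Real.exp (-d)) := by
    calc _ ≤ n ^ 2 * Real.exp (2 * K + (-d)) := by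
          gcongr
          linarith
      _ = _ := by rw [Real.exp_add]; ring
  have b5 : (n : ℝ) ^ (2 * d) * ((1 - (1 - (p : ℝ)) ^ κ) ^ d) ^ d ≤ n ^ 2 * Real.exp (-d) := by
    have h0 : (0 : ℝ) ≤ 1 - (1 - p) ^ κ :=
      sub_nonneg.2 (pow_le_one₀ (one_sub_coe_nonneg p) (one_sub_coe_le_one p))
    have h1 : 1 - (1 - (p : ℝ)) ^ κ ≤ Real.exp (-θ) := by
      have := Real.add_one_le_exp (-θ)
      linarith
    calc _ ≤ (Real.exp (Real.log n)) ^ (2 * d) * ((Real.exp (-θ)) ^ d) ^ d := by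
          rw [Real.exp_log hn0]
          gcongr
      -- The `n ^ (2 * d)` choices of two `d`-sets are beaten by `exp (-θ * d ^ 2)`, since `d`
      -- dominates `log n`.
      _ = Real.exp (d * (2 * Real.log n - θ * d)) := by
          rw [← Real.exp_nat_mul, ← Real.exp_nat_mul, ← Real.exp_nat_mul, ← Real.exp_add]
          push_cast
          ring_nf
      _ ≤ Real.exp (-d) := by
          gcongr
          calc (d : ℝ) * (2 * Real.log n - θ * d) ≤ d * (-1) := by
                gcongr
                linarith
            _ = _ := by ring
      _ ≤ _ := le_mul_of_one_le_left (Real.exp_pos _).le (by linarith)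
  have hE : 1 ≤ Real.exp (2 * K) := Real.one_le_exp (by linarith)
  have hpos : 0 ≤ n ^ 2 * Real.exp (-(d : ℝ)) := by positivity
  have hE' := mul_le_mul_of_nonneg_right hE hpos
  have hlaw : (labelLaw n m p).real {S | ¬ Typical S (n * p) (θ / 8) d} ≤ _ := h
  refine hlaw.trans ?_
  linarith

theorem exp_neg_two_mul_le_one_sub {x : ℝ} (h0 : 0 ≤ x) (h1 : x ≤ 1 / 2) :
    Real.exp (-(2 * x)) ≤ 1 - x := by
  have h2 := Real.add_one_le_exp (2 * x)
  rw [Real.exp_neg, inv_eq_one_div, div_le_iff₀ (Real.exp_pos _)]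
  nlinarith

theorem eventually_le_natCast_rpow {ε : ℝ} (hε : 0 < ε) (A : ℝ) :
    ∀ᶠ n : ℕ in atTop, A ≤ (n : ℝ) ^ ε :=
  ((tendsto_rpow_atTop hε).comp tendsto_natCast_atTop_atTop).eventually_ge_atTop A

theorem eventually_log_le_mul_rpow {ε c : ℝ} (hε : 0 < ε) (hc : 0 < c) :
    ∀ᶠ n : ℕ in atTop, Real.log n ≤ c * (n : ℝ) ^ ε := by
  have h := tendsto_natCast_atTop_atTop.eventually ((isLittleO_log_rpow_atTop hε).def hc)
  filter_upwards [h] with n hn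
  refine (le_abs_self _).trans (hn.trans (le_of_eq ?_))
  rw [Real.norm_of_nonneg (by positivity)]

/-- The asymptotic parameter bounds, expressed through the small power `n ^ ε` of `n`. -/
theorem eventually_parameter_bounds {α : ℝ} (hα0 : 0 < α) (hα1 : α < 1) {m : ℕ → ℕ}
    (hm : ∀ n, |(m n : ℝ) - (n : ℝ) ^ α| < 1) {p : ℕ → unitInterval}
    (hp : (fun n : ℕ => 1 / Real.sqrt ((n : ℝ) * (m n : ℝ))) =O[atTop] fun n => (p n : ℝ))
    (hmp : (fun n : ℕ => (m n : ℝ) * (p n : ℝ) ^ 2) =O[atTop] fun _ => (1 : ℝ)) :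
    ∃ ε : ℝ, 0 < ε ∧ ∃ C : ℝ, 1 ≤ C ∧ ∀ᶠ n : ℕ in atTop, m n ≤ n ∧
      ((n : ℝ) ^ ε) ^ 20 ≤ 2 * Real.sqrt (m n) ∧ p n * Real.sqrt (m n) ≤ C ∧
      ((n : ℝ) ^ ε) ^ 20 ≤ C * (n * p n) := by
  obtain ⟨c, hc⟩ := hp.bound
  obtain ⟨D, hD⟩ := hmp.bound
  set C : ℝ := 2 * max c 0 + max D 0 + 1 with hC
  have hc0 := le_max_right c 0
  have hD0 := le_max_right D 0
  have hC1 : 1 ≤ C := by linarith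
  set γ : ℝ := min α (1 - α) with hγ
  have hγ0 : 0 < γ := lt_min hα0 (by linarith)
  -- The 40th power of `n ^ ε` is then below both `n ^ α` and `n ^ (1 - α)`. After square roots this
  -- gives the exponent 20, enough for the powers of `d` up to 13 with room for constants.
  refine ⟨γ / 40, by positivity, C, hC1, ?_⟩
  filter_upwards [hc, hD, eventually_ge_atTop 1,
    eventually_le_natCast_rpow (show 0 < γ / 40 by positivity) 2] with n hcn hDn hn1 hx2
  have hn1' : (1 : ℝ) ≤ n := by exact_mod_cast hn1
  have hn0 : (0 : ℝ) < n := by linarith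
  set x : ℝ := (n : ℝ) ^ (γ / 40) with hx
  have hx40 : x ^ 40 = (n : ℝ) ^ γ := by
    rw [hx, ← Real.rpow_natCast, ← Real.rpow_mul hn0.le]
    congr 1
    push_cast
    ring
  set y : ℝ := (n : ℝ) ^ α with hy
  set z : ℝ := (n : ℝ) ^ (1 - α) with hz
  have hyz : y * z = n := by
    rw [hy, hz, ← Real.rpow_add hn0]
    simp
  have hxy : x ^ 40 ≤ y := by
    rw [hx40]
    exact Real.rpow_le_rpow_of_exponent_le hn1' (min_le_left _ _)
  have hxz : x ^ 40 ≤ z := by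
    rw [hx40]
    exact Real.rpow_le_rpow_of_exponent_le hn1' (min_le_right _ _)
  have hx40' : 2 ≤ x ^ 40 := by
    calc (2 : ℝ) ≤ x := hx2
      _ ≤ x ^ 40 := le_self_pow₀ (by linarith) (by norm_num)
  obtain ⟨hm1, hm2⟩ := abs_lt.1 (hm n)
  have hmy : (m n : ℝ) ≤ 2 * y := by linarith
  have hmx : x ^ 40 / 4 ≤ m n := by linarith
  have hm0 : (0 : ℝ) < m n := lt_of_lt_of_le (by linarith) hmx
  have hp0 : (0 : ℝ) ≤ p n := (p n).2.1
  have hy0 : 0 < y := by linarith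
  refine ⟨?_, ?_, ?_, ?_⟩
  · have : (m n : ℝ) ≤ n := by
      calc (m n : ℝ) ≤ y * 2 := by linarith
        _ ≤ y * z := by gcongr; linarith
        _ = n := hyz
    exact_mod_cast this
  · have : x ^ 20 / 2 ≤ Real.sqrt (m n) := by
      apply Real.le_sqrt_of_sq_le
      calc (x ^ 20 / 2) ^ 2 = x ^ 40 / 4 := by ring
        _ ≤ _ := hmx
    linarith
  · refine abs_le_of_sq_le_sq' ?_ (by linarith) |>.2
    rw [mul_pow, Real.sq_sqrt hm0.le]
    have h1 : (m n : ℝ) * (p n : ℝ) ^ 2 ≤ D := by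
      rw [norm_one, mul_one, Real.norm_of_nonneg (by positivity)] at hDn
      exact hDn
    have h2 := le_max_left D 0
    have h3 : C ≤ C ^ 2 := le_self_pow₀ hC1 (by norm_num)
    rw [mul_comm]
    linarith
  · have h1 : 1 ≤ max c 0 * p n * Real.sqrt (n * m n) := by
      rw [Real.norm_of_nonneg (by positivity), Real.norm_of_nonneg hp0,
        div_le_iff₀ (by positivity)] at hcn
      refine hcn.trans ?_
      gcongr
      exact le_max_left _ _
    refine abs_le_of_sq_le_sq' ?_ (by positivity) |>.2
    have h2 : 1 ≤ (max c 0 * p n) ^ 2 * (n * m n) := by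
      have := pow_le_pow_left₀ zero_le_one h1 2
      rwa [one_pow, mul_pow, Real.sq_sqrt (by positivity)] at this
    -- As `m ≤ 2 * y` and `n = y * z`, the lower bound on `p` says that `(n * p) ^ 2` is at least of
    -- order `n / m`, hence of order `z`.
    have h3 : z ≤ 2 * (max c 0 * (n * p n)) ^ 2 := by
      have h4 : 1 ≤ (max c 0 * p n) ^ 2 * (n * (2 * y)) := h2.trans (by gcongr)
      have h5 : y * z ≤ n * ((max c 0 * p n) ^ 2 * (n * (2 * y))) := by
        rw [hyz]
        exact le_mul_of_one_le_right hn0.le h4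
      refine le_of_mul_le_mul_left (h5.trans (le_of_eq ?_)) hy0
      ring
    calc (x ^ 20) ^ 2 = x ^ 40 := by ring
      _ ≤ z := hxz
      _ ≤ 2 * (max c 0 * (n * p n)) ^ 2 := h3
      _ ≤ (2 * (max c 0 * (n * p n))) ^ 2 := by
          rw [mul_pow (2 : ℝ)]
          linarith [sq_nonneg (max c 0 * (n * p n))]
      _ ≤ (C * (n * p n)) ^ 2 := by
          have h6 : 2 * max c 0 ≤ C := by linarith
          rw [← mul_assoc]
          gcongr

/-- All preimages of the graph form a single class up to labels, so there is no other candidate with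
which to compare posteriors. -/
theorem maximumLikelihoodSolvable_of_unique {n m : ℕ} (p : unitInterval)
    {S : Fin n → Set (Fin m)}
    (h : ∀ T : Fin n → Set (Fin m), intersectionGraph T = intersectionGraph S →
      EqUpToLabels (bipartiteGraph S) (bipartiteGraph T)) :
    MaximumLikelihoodSolvable n m p (intersectionGraph S) :=
  ⟨S, rfl, fun T hT hne => absurd (h T hT) hne⟩

theorem labelLaw_tendsto_of_eventually_le {m : ℕ → ℕ} {p : ℕ → unitInterval}
    {E F : ∀ n, Set (Fin n → Set (Fin (m n)))} {K : ℝ}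
    (hEF : ∀ᶠ n in atTop, (E n)ᶜ ⊆ F n)
    (hF : ∀ᶠ n : ℕ in atTop, (labelLaw n (m n) (p n)).real (F n) ≤ K / n) :
    Tendsto (fun n => labelLaw n (m n) (p n) (E n)) atTop (nhds 1) := by
  have hprob : ∀ n, IsProbabilityMeasure (labelLaw n (m n) (p n)) := fun n => by
    unfold labelLaw; infer_instance
  have hreal : Tendsto (fun n => (labelLaw n (m n) (p n)).real (E n)) atTop (nhds 1) := by
    have h1 : Tendsto (fun n : ℕ => 1 - K / n) atTop (nhds 1) := by
      simpa using (tendsto_const_div_atTop_nhds_zero_nat K).const_sub 1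
    refine tendsto_of_tendsto_of_tendsto_of_le_of_le' h1 tendsto_const_nhds ?_
      (Eventually.of_forall fun n => measureReal_le_one)
    filter_upwards [hEF, hF] with n h2 h3
    have h4 := probReal_compl_eq_one_sub (μ := labelLaw n (m n) (p n)) (s := E n) .of_discrete
    have h5 := measureReal_mono (μ := labelLaw n (m n) (p n)) h2
    linarith
  have h := ENNReal.tendsto_ofReal hreal
  simpa using h

/-- The bound on the probability of atypical label choices when all the parameters are compared
with a large number `x`. -/
theorem admissible_and_labelLaw_real_not_typical_le {n m d : ℕ} {p : unitInterval}
    {C K θ x : ℝ} (hC : 1 ≤ C) (hK : K = C * (2 * C + 1) + 1) (hθ : θ = Real.exp (-(2 * K)))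
    (hxA : 10 ^ 8 * C * (8 / θ) ^ 4 ≤ x) (hdx : x ≤ d) (hd2 : (d : ℝ) ≤ 2 * x) (hn : 2 ≤ n)
    (hmn : m ≤ n) (hsqrt : x ^ 20 ≤ 2 * Real.sqrt m) (hpm : p * Real.sqrt m ≤ C)
    (hnp : x ^ 20 ≤ C * (n * p)) (hlog : Real.log n ≤ θ / 3 * x) :
    Admissible (n * p) (θ / 8) d ∧ (labelLaw n m p).real {S | ¬ Typical S (n * p) (θ / 8) d} ≤
      6 * Real.exp (2 * K) * (n ^ 2 * Real.exp (-d)) := by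
  have hK0 : 0 < K := by rw [hK]; positivity
  have hθ0 : 0 < θ := by rw [hθ]; exact Real.exp_pos _
  have hθ1 : θ ≤ 1 := by rw [hθ]; exact Real.exp_le_one_iff.2 (by linarith)
  have hθ8 : 1 ≤ 8 / θ := by rw [le_div_iff₀ hθ0]; linarith
  have hx8 : 10 ^ 8 * C ≤ x :=
    (le_mul_of_one_le_right (by positivity) (one_le_pow₀ hθ8)).trans hxA
  have hA2 : 10 ^ 8 * C * (8 / θ) ≤ x := by
    refine le_trans ?_ hxA
    gcongr
    exact le_self_pow₀ hθ8 (by norm_num)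
  have hA3 : 1000 * (8 / θ) ^ 4 ≤ x := by
    refine le_trans ?_ hxA
    gcongr
    linarith
  have hn2 : (2 : ℝ) ≤ n := by exact_mod_cast hn
  have hp0 : (0 : ℝ) ≤ p := p.2.1
  have hx1 : 10 ^ 8 ≤ x := by linarith
  have hx0 : 0 < x := by linarith
  have hdpow : ∀ k : ℕ, (d : ℝ) ^ k ≤ 2 ^ k * x ^ k := fun k => by
    rw [← mul_pow]
    gcongr
  have hxpow : ∀ k : ℕ, k ≤ 13 → x ^ k * x ≤ x ^ 20 := fun k hk => by
    rw [← pow_succ]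
    exact pow_le_pow_right₀ (by linarith) (by omega)
  have hs1 : x ^ 20 / 2 ≤ Real.sqrt m := by linarith
  have hx20 : x ≤ x ^ 20 := le_self_pow₀ (by linarith) (by norm_num)
  have hs0 : 0 < Real.sqrt m := by linarith
  have hdpos : 0 < d := by
    have : (0 : ℝ) < d := by linarith
    exact_mod_cast this
  have hp13 : 100 * (d : ℝ) ^ 13 ≤ n * p := by
    have h1 : C * (100 * (d : ℝ) ^ 13) ≤ C * (n * p) := by
      calc _ ≤ C * (100 * (2 ^ 13 * x ^ 13)) := by gcongr; exact hdpow 13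
        _ ≤ x ^ 13 * (10 ^ 8 * C) := by
            have : 0 ≤ C * x ^ 13 := by positivity
            linarith
        _ ≤ x ^ 13 * x := by gcongr
        _ ≤ x ^ 20 := hxpow 13 le_rfl
        _ ≤ _ := hnp
    exact le_of_mul_le_mul_left h1 (by linarith)
  have hsmall : 128 * (p : ℝ) * d ^ 11 ≤ 1 := by
    have h1 : (p : ℝ) * x ^ 20 ≤ 2 * C := by
      calc (p : ℝ) * x ^ 20 ≤ p * (2 * Real.sqrt m) := by gcongr
        _ = 2 * (p * Real.sqrt m) := by ring
        _ ≤ 2 * C := by gcongr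
    have h2 : 10 ^ 8 * C * (128 * (p : ℝ) * d ^ 11) ≤ 10 ^ 8 * C * 1 := by
      calc _ ≤ x * (128 * (p : ℝ) * (2 ^ 11 * x ^ 11)) := by
            gcongr
            exact hdpow 11
        _ = 128 * 2 ^ 11 * (p * (x ^ 11 * x)) := by ring
        _ ≤ 128 * 2 ^ 11 * (p * x ^ 20) := by
            gcongr
            exact hxpow 11 (by norm_num)
        _ ≤ _ := by linarith
    exact le_of_mul_le_mul_left h2 (by positivity)
  have hdN : (d : ℝ) ≤ θ / 8 * (n * p) := by
    have h1 : C * (8 / θ) * (d : ℝ) ≤ C * (n * p) := by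
      calc _ ≤ C * (8 / θ) * (2 * x) := by gcongr
        _ ≤ x * (10 ^ 8 * C * (8 / θ)) := by
            have : 0 ≤ C * (8 / θ) * x := by positivity
            linarith
        _ ≤ x ^ 1 * x := by
            rw [pow_one]
            gcongr
        _ ≤ x ^ 20 := hxpow 1 (by norm_num)
        _ ≤ _ := hnp
    have h2 : 8 / θ * (d : ℝ) ≤ n * p := by
      rw [mul_assoc] at h1
      exact le_of_mul_le_mul_left h1 (by linarith)
    calc (d : ℝ) = θ / 8 * (8 / θ * d) := by field_simp
      _ ≤ _ := by gcongr
  have hadm : Admissible (n * p) (θ / 8) d := by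
    refine ⟨by positivity, by linarith, ?_, hp13⟩
    calc (1000 : ℝ) = (θ / 8) ^ 4 * (1000 * (8 / θ) ^ 4) := by field_simp
      _ ≤ (θ / 8) ^ 4 * d := by
          gcongr
          exact hA3.trans hdx
  refine ⟨hadm, ?_⟩
  -- Of `2 * C + 1`, the part `2 * C` absorbs `2 * p * m = 2 * (p * √m) * √m` and the 1 absorbs `d ≤
  -- √m`. Still `p * κ ≤ K`, which keeps `(1 - p) ^ κ` above `θ = exp (-2 * K)`.
  set κ : ℕ := ⌈(2 * C + 1) * Real.sqrt m⌉₊ with hκ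
  have hκ1 : (2 * C + 1) * Real.sqrt m ≤ κ := Nat.le_ceil _
  have hκ2 : (κ : ℝ) ≤ (2 * C + 1) * Real.sqrt m + 1 :=
    (Nat.ceil_lt_add_one (by positivity)).le
  have hpK : (p : ℝ) * κ ≤ K := by
    have h1 : (p : ℝ) ≤ 1 := p.2.2
    calc p * (κ : ℝ) ≤ p * ((2 * C + 1) * Real.sqrt m + 1) := by gcongr
      _ = (p * Real.sqrt m) * (2 * C + 1) + p := by ring
      _ ≤ C * (2 * C + 1) + 1 := by gcongr
      _ = K := hK.symm
  have hphalf : (p : ℝ) ≤ 1 / 2 := by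
    have h1 : (1 : ℝ) ≤ (d : ℝ) ^ 11 := one_le_pow₀ (by linarith)
    have h2 : 128 * (p : ℝ) * 1 ≤ 128 * p * d ^ 11 := by gcongr
    linarith
  have hθκ : θ ≤ (1 - (p : ℝ)) ^ κ := by
    calc θ ≤ Real.exp (κ * (-(2 * p))) := by
          rw [hθ]
          gcongr
          linarith
      _ = Real.exp (-(2 * p)) ^ κ := Real.exp_nat_mul _ _
      _ ≤ _ := by
          gcongr
          exact exp_neg_two_mul_le_one_sub hp0 hphalf
  have hκd : 2 * (p : ℝ) * m + d ≤ κ := by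
    have h1 : 2 * (p : ℝ) * m = 2 * (p * Real.sqrt m) * Real.sqrt m := by
      rw [mul_assoc 2 _ (Real.sqrt m), mul_assoc (p : ℝ), Real.mul_self_sqrt (Nat.cast_nonneg _),
        mul_assoc]
    have h2 : 2 * (p * Real.sqrt m) * Real.sqrt m ≤ 2 * C * Real.sqrt m := by
      gcongr
    have h3 : (d : ℝ) ≤ Real.sqrt m := by
      have := hxpow 1 (by norm_num)
      have h4 : 10 ^ 8 * x ≤ x ^ 1 * x := by rw [pow_one]; gcongr
      linarith
    linarith
  have hlog' : 2 * Real.log n + 1 ≤ θ * d := by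
    have h1 : θ * x ≤ θ * d := by gcongr
    have h2 : 3 ≤ θ * x := by
      have : 8 / θ ≤ x := by
        refine le_trans ?_ hA2
        exact le_mul_of_one_le_left (by positivity) (by linarith)
      rw [div_le_iff₀ hθ0] at this
      linarith
    linarith
  have hN64 : 64 * (d : ℝ) ^ 12 ≤ n * p := by
    refine le_trans ?_ (hadm.pow_le (k := 12) (by norm_num))
    gcongr
    norm_num
  exact (labelLaw_real_not_typical_le hn hmn hdpos hθ0 hθκ hκd hsmall hN64 hdN hpK
    hlog')

end RandomIntersection

open RandomIntersection in
theorem theorem4 (α : ℝ) (hα0 : 0 < α) (hα1 : α < 1) (m : ℕ → ℕ)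
    (hm : ∀ n, |(m n : ℝ) - (n : ℝ) ^ α| < 1) (p : ℕ → unitInterval)
    (hp : (fun n : ℕ => 1 / Real.sqrt ((n : ℝ) * (m n : ℝ))) =O[atTop] fun n => (p n : ℝ))
    (hmp : (fun n : ℕ => (m n : ℝ) * (p n : ℝ) ^ 2) =O[atTop] fun _ => (1 : ℝ)) :
    Tendsto (fun n => labelLaw n (m n) (p n)
      {S | (∀ T : Fin n → Set (Fin (m n)), intersectionGraph T = intersectionGraph S →
            EqUpToLabels (bipartiteGraph S) (bipartiteGraph T)) ∧
          MaximumLikelihoodSolvable n (m n) (p n) (intersectionGraph S)})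
      atTop (nhds 1) := by
  obtain ⟨ε, hε, C, hC, hbounds⟩ := eventually_parameter_bounds hα0 hα1 hm hp hmp
  set K : ℝ := C * (2 * C + 1) + 1 with hK
  set θ : ℝ := Real.exp (-(2 * K)) with hθ
  have hθ0 : 0 < θ := Real.exp_pos _
  let d : ℕ → ℕ := fun n => ⌈(n : ℝ) ^ ε⌉₊
  have hparams : ∀ᶠ n : ℕ in atTop, Admissible (n * p n) (θ / 8) (d n) ∧
      (labelLaw n (m n) (p n)).real {S | ¬ Typical S (n * p n) (θ / 8) (d n)} ≤
        6 * Real.exp (2 * K) / n := by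
    filter_upwards [hbounds, eventually_ge_atTop 2,
      eventually_le_natCast_rpow hε (10 ^ 8 * C * (8 / θ) ^ 4),
      eventually_log_le_mul_rpow hε (show 0 < θ / 3 by positivity)]
      with n ⟨hmn, hsqrt, hpm, hnp⟩ hn hxA hlog
    set x : ℝ := (n : ℝ) ^ ε with hx
    have hn2 : (2 : ℝ) ≤ n := by exact_mod_cast hn
    have hθ1 : θ ≤ 1 := Real.exp_le_one_iff.2 (by linarith [show 0 ≤ K by positivity])
    have hx1 : 1 ≤ x := Real.one_le_rpow (by linarith) hε.le
    have hdx : x ≤ d n := Nat.le_ceil _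
    have hd2 : (d n : ℝ) ≤ 2 * x := by
      have := (Nat.ceil_lt_add_one (show 0 ≤ x by linarith)).le
      linarith
    have hmain := admissible_and_labelLaw_real_not_typical_le hC hK hθ hxA hdx hd2 hn hmn hsqrt
      hpm hnp hlog
    refine ⟨hmain.1, hmain.2.trans ?_⟩
    rw [div_eq_mul_inv]
    gcongr
    have hn0 : (0 : ℝ) < n := by linarith
    -- Here `d ≥ x ≥ 3 * log n`; the third power of `n` leaves `1 / n` after the factor `n ^ 2`.
    have h1 : Real.exp (-(d n : ℝ)) ≤ ((n : ℝ) ^ 3)⁻¹ := by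
      rw [Real.exp_neg]
      gcongr
      calc (n : ℝ) ^ 3 = Real.exp (3 * Real.log n) := by
            rw [← Real.exp_log hn0, ← Real.exp_nat_mul, Real.log_exp]
            norm_num
        _ ≤ _ := by
            gcongr
            have : θ / 3 * x ≤ 1 / 3 * x := by gcongr
            linarith
    calc (n : ℝ) ^ 2 * Real.exp (-(d n : ℝ)) ≤ n ^ 2 * ((n : ℝ) ^ 3)⁻¹ := by gcongr
      _ = _ := by field_simp
  refine labelLaw_tendsto_of_eventually_le (K := 6 * Real.exp (2 * K))
    (F := fun n => {S | ¬ Typical S (n * p n) (θ / 8) (d n)}) ?_ (hparams.mono fun n h => h.2)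
  filter_upwards [hparams] with n hn S hS hT
  have huniq : ∀ T : Fin n → Set (Fin (m n)), intersectionGraph T = intersectionGraph S →
      EqUpToLabels (bipartiteGraph S) (bipartiteGraph T) := fun T => hT.eqUpToLabels hn.1
  exact hS ⟨huniq, maximumLikelihoodSolvable_of_unique (p n) huniq⟩
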